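/- Let $(\mathcal X,\mathfrak S,\mu)$ be a $\sigma$-finite measure space with an increasing sequence of $\sigma$-algebras $\mathfrak S_n\subset\mathfrak S_{n+1}\subset\mathfrak S$, $n\in\mathbb Z$, each of which is atomic: there is a countable disjoint collection $\mathscr D_n\subset\mathfrak S_n$ of sets of positive finite measure (atoms) such that every $A\in\mathfrak S_n$ is a union of members of $\mathscr D_n$. Put $\mathscr D=\bigcup_{n}\mathscr D_n$, write $|A|=\mu(A)$, $dx=d\mu(x)$, $\langle g\rangle_I=|I|^{-1}\int_I g\,dx$, and let $Mg(x)=\sup\{\langle |g|\rangle_I: I\in\mathscr D,\ x\in I\}$ be the martingale maximal function. A family $\mathcal Q\subset\mathscr D$ is called sparse if $\bigl|\bigcup_{I\in\mathcal Q,\,I\subsetneq I_0}I\bigr|\le\frac12|I_0|$ for every $I_0\in\mathcal Q$; the corresponding sparse (Lerner type) operator is $$T_{\mathcal Q}\,g=\sum_{I\in\mathcal Q}\langle g\rangle_I\,\mathbf 1_I .$$ Let $\alpha:[1,\infty)\to(0,\infty)$ be such that $t\mapsto t\alpha(t)$ is non-decreasing and $\int_1^\infty\frac{dt}{t\alpha(t)}<\infty$.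 Let $u,v\ge0$ be weights on $\mathcal X$, that is, measurable functions integrable over each $I\in\mathscr D$; write $\mathbf u_I=\langle u\rangle_I$, $\mathbf u_I^*=\langle M(\mathbf 1_Iu)\rangle_I$, and similarly $\mathbf v_I$, $\mathbf v_I^*$. Assume the separated (one-sided) entropy bump conditions $$\sup_{I\in\mathscr D}\alpha\bigl(\mathbf u_I^*/\mathbf u_I\bigr)^2\,\mathbf u_I^*\,\mathbf v_I<\infty,\qquad \sup_{I\in\mathscr D}\alpha\bigl(\mathbf v_I^*/\mathbf v_I\bigr)^2\,\mathbf v_I^*\,\mathbf u_I<\infty,$$ where both expressions are taken to be $0$ if $\mathbf u_I=0$ or $\mathbf v_I=0$, and otherwise to be $+\infty$ if the entropy average $\mathbf u_I^*$, respectively $\mathbf v_I^*$, that occurs in them is infinite. Then there is a constant $C<\infty$ such that for every sparse family $\mathcal Q\subset\mathscr D$, with $T=T_{\mathcal Q}$, and for every (real or complex valued) $f\in L^2(u)$ the series defining $T(fu)$ converges absolutely $v\,dx$-almost everywhere and $$\int_{\mathcal X}|T(fu)|^2\,v\,dx\le C\int_{\mathcal X}|f|^2\,u\,dx .$$ -/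

import Mathlib

open MeasureTheory Set
open scoped ENNReal NNReal

namespace EntropyBump

variable {X : Type*} [m0 : MeasurableSpace X]

/-- A filtration `(𝔖ₙ)`, `n ∈ ℤ`, of atomic σ-algebras on the measure space `(X, μ)`: for each `n`
there is a countable disjoint collection `atoms n` of `𝔖ₙ`-measurable sets of positive (and finite)
measure such that every set of `𝔖ₙ` is a union of members of `atoms n`. The same set may be an atom
of several generations. -/
structure AtomicFiltration (μ : Measure X) where
  /-- the increasing family of σ-algebras -/
  filtration : Filtration ℤ m0
  /-- the atoms of generation `n` -/
  atoms : ℤ → Set (Set X)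
  countable_atoms : ∀ n, (atoms n).Countable
  pairwiseDisjoint_atoms : ∀ n, (atoms n).PairwiseDisjoint id
  measurableSet_atom : ∀ n, ∀ I ∈ atoms n, MeasurableSet[filtration n] I
  measure_atom_pos : ∀ n, ∀ I ∈ atoms n, 0 < μ I
  measure_atom_lt_top : ∀ n, ∀ I ∈ atoms n, μ I < ∞
  exists_eq_sUnion : ∀ n, ∀ A : Set X, MeasurableSet[filtration n] A →
    ∃ S ⊆ atoms n, A = ⋃₀ S

namespace AtomicFiltration

variable {μ : Measure X} (𝓕 : AtomicFiltration μ)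

/-- The collection `𝒟` of the atoms of all generations. -/
def lattice : Set (Set X) := ⋃ n, 𝓕.atoms n

/-- The martingale maximal function `M w (x) = sup {⟨w⟩_I : I ∈ 𝒟, x ∈ I}` of a nonnegative
function `w`. -/
noncomputable def maximal (w : X → ℝ≥0∞) (x : X) : ℝ≥0∞ :=
  ⨆ I ∈ 𝓕.lattice, ⨆ _ : x ∈ I, ⨍⁻ y in I, w y ∂μ

/-- The average `u_I = ⟨u⟩_I` of a weight. -/
noncomputable def avg (_𝓕 : AtomicFiltration μ) (u : X → ℝ≥0) (I : Set X) : ℝ≥0∞ :=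
  ⨍⁻ x in I, (u x : ℝ≥0∞) ∂μ

/-- The entropy average `u*_I = ⟨M(𝟏_I u)⟩_I` of a weight. -/
noncomputable def entropyAvg (u : X → ℝ≥0) (I : Set X) : ℝ≥0∞ :=
  ⨍⁻ x in I, 𝓕.maximal (I.indicator fun y => (u y : ℝ≥0∞)) x ∂μ

/-- The one-sided entropy bump condition `sup_{I ∈ 𝒟} α(u*_I / u_I)² u*_I v_I < ∞`.
The expression counts as `0` where `u_I = 0` or `v_I = 0`, and as `∞` where `u_I, v_I > 0` and
`u*_I = ∞`. -/
def OneSidedBump (α : ℝ → ℝ) (u v : X → ℝ≥0) : Prop :=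
  ∃ A : ℝ, ∀ I ∈ 𝓕.lattice, 𝓕.avg u I ≠ 0 → 𝓕.avg v I ≠ 0 →
    𝓕.entropyAvg u I ≠ ∞ ∧
      α ((𝓕.entropyAvg u I).toReal / (𝓕.avg u I).toReal) ^ 2 *
        (𝓕.entropyAvg u I).toReal * (𝓕.avg v I).toReal ≤ A

/-- A family `Q ⊆ 𝒟` is sparse if for each `I₀ ∈ Q` the union of all `I ∈ Q` properly contained in
`I₀` has measure at most `|I₀| / 2`. -/
structure IsSparse (Q : Set (Set X)) : Prop where
  subset_lattice : Q ⊆ 𝓕.lattice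
  measure_le : ∀ I₀ ∈ Q, μ (⋃₀ {I | I ∈ Q ∧ I ⊂ I₀}) ≤ μ I₀ / 2

end AtomicFiltration

variable {𝕜 : Type*} [RCLike 𝕜]

/-- The term `⟨g⟩_I 𝟏_I` of a sparse operator. -/
noncomputable def sparseTerm (μ : Measure X) (g : X → 𝕜) (I : Set X) : X → 𝕜 :=
  I.indicator fun _ => ⨍ y in I, g y ∂μ

/-- The sparse (Lerner type) operator `T_Q g = ∑_{I ∈ Q} ⟨g⟩_I 𝟏_I`. -/
noncomputable def sparseOp (μ : Measure X) (Q : Set (Set X)) (g : X → 𝕜) (x : X) : 𝕜 :=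
  ∑' I : Q, sparseTerm μ g (I : Set X) x

end EntropyBump

/-! Put `σ = u dμ` and `ω = v dμ`. By duality it suffices to bound the form `∑ (∫_J F dσ) (∫_J G dω)
/ μ J` over finite sparse families, uniformly in the family. With `a J`, `b J` the averages of `F`,
`G` against `σ`, `ω`, the terms are split according to which of `a J ^ 2 * σ J` and `b J ^ 2 * ω J`
is larger. Each half then needs only one testing condition, hence only one of the two bumps.

In the half where `F` dominates (`sum_average_mul_le_of_testing`), stopping sets are placed where
the dyadic level of the averages of `F` rises. For the sets of the level of a stopping set `S`, `G`
may be replaced by its averages on the stopping children of `S`. Testing then leaves `a S ^ 2 * σ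
S`, the integral of `G ^ 2` over `S` minus its children, and `∑ b J ^ 2 * ω J` over the children.
The integrals live on disjoint sets. The last sum is at most `∑ a J ^ 2 * σ J`, so Carleson
embedding for `F` (`sum_sq_average_stoppingSets_le`) controls everything else.

For the testing constant, the family is cut into classes on which `u*_I / u_I` is about `2 ^ n`.
Sparseness gives testing with constant `8 * c * D` (`IsSparse.testing`), where `c` bounds `u_I v_I`
and `D` bounds the ratio. The bump makes `c` of order `1 / (2 ^ n * α (2 ^ n) ^ 2)` while `D = 2 ^
(n + 1)`, so the class `n` contributes a multiple of `1 / α (2 ^ n)`. These sum up by the integral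
condition on `α`. -/

namespace EntropyBump

/-! ### Elementary inequalities in `ℝ≥0∞` -/

/-- Young's inequality, used in place of Cauchy–Schwarz so that no roots of integrals appear. -/
lemma two_mul_mul_le_add_sq_inv (x y : ℝ≥0∞) {t : ℝ≥0} (ht : t ≠ 0) :
    2 * (x * y) ≤ (t : ℝ≥0∞)⁻¹ * x ^ 2 + t * y ^ 2 := by
  have ht' : (t : ℝ≥0∞)⁻¹ ≠ 0 := ENNReal.inv_ne_zero.2 ENNReal.coe_ne_top
  have ht'' : (t : ℝ≥0∞) ≠ 0 := by exact_mod_cast ht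
  induction x with
  | top => simp [ENNReal.top_pow, ENNReal.mul_top ht']
  | coe x =>
    induction y with
    | top => simp [ENNReal.top_pow, ENNReal.mul_top ht'']
    | coe y =>
      rw [← ENNReal.coe_inv ht]
      norm_cast
      rw [← NNReal.coe_le_coe]
      push_cast
      have h : (0 : ℝ) < t := by positivity
      have : ((t : ℝ)⁻¹ * x ^ 2 + t * y ^ 2) - 2 * (x * y) = (t : ℝ)⁻¹ * (x - t * y) ^ 2 := by
        field_simp
        ring
      have : 0 ≤ (t : ℝ)⁻¹ * (x - t * y) ^ 2 := by positivity
      linarith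

lemma sum_two_zpow_le (T : Finset ℤ) :
    ∀ n : ℤ, (∀ j ∈ T, j ≤ n) → ∑ j ∈ T, (2 : ℝ≥0∞) ^ j ≤ 2 ^ (n + 1) := by
  induction T using Finset.induction_on_max with
  | empty => simp
  | insert m s hm ih =>
    intro n hn
    have hms : m ∉ s := fun h => lt_irrefl _ (hm m h)
    rw [Finset.sum_insert hms]
    have h1 := ih (m - 1) fun j hj => by have := hm j hj; omega
    have hmn := hn m (Finset.mem_insert_self _ _)
    calc (2 : ℝ≥0∞) ^ m + ∑ j ∈ s, 2 ^ j ≤ 2 ^ m + 2 ^ m := by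
          gcongr
          simpa using h1
      _ = 2 ^ (m + 1) := by
          rw [ENNReal.zpow_add (by norm_num) (by norm_num)]
          simp [mul_two]
      _ ≤ 2 ^ (n + 1) := ENNReal.zpow_le_of_le (by norm_num) (by omega)

/-- The terms have distinct dyadic sizes, so the sum is comparable to its term of highest level. -/
lemma sq_sum_le_of_injOn {ι : Type*} (Y : Finset ι) (k : ι → ℤ) (hk : Set.InjOn k Y)
    (a : ι → ℝ≥0∞) (hl : ∀ i ∈ Y, 2 ^ k i ≤ a i) (hu : ∀ i ∈ Y, a i ≤ 2 ^ (k i + 1)) :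
    (∑ i ∈ Y, a i) ^ 2 ≤ 16 * ∑ i ∈ Y, a i ^ 2 := by
  classical
  rcases Y.eq_empty_or_nonempty with rfl | hne
  · simp
  obtain ⟨i₀, hi₀, hmax⟩ := Y.exists_max_image k hne
  -- One factor 2 comes from rounding each term up to a power of 2, the other from the geometric
  -- series.
  have h1 : ∑ i ∈ Y, a i ≤ 4 * a i₀ := by
    calc ∑ i ∈ Y, a i ≤ ∑ i ∈ Y, 2 * (2 : ℝ≥0∞) ^ k i := by
          refine Finset.sum_le_sum fun i hi => (hu i hi).trans_eq ?_
          rw [ENNReal.zpow_add (by norm_num) (by norm_num), zpow_one, mul_comm]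
      _ = 2 * ∑ j ∈ Y.image k, (2 : ℝ≥0∞) ^ j := by
          rw [Finset.sum_image hk, Finset.mul_sum]
      _ ≤ 2 * 2 ^ (k i₀ + 1) := by
          gcongr
          exact sum_two_zpow_le _ _ (by simpa using hmax)
      _ = 4 * 2 ^ k i₀ := by
          rw [ENNReal.zpow_add (by norm_num) (by norm_num), zpow_one]
          ring
      _ ≤ 4 * a i₀ := by
          gcongr
          exact hl _ hi₀
  calc (∑ i ∈ Y, a i) ^ 2 ≤ (4 * a i₀) ^ 2 := by gcongr
    _ = 16 * a i₀ ^ 2 := by ring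
    _ ≤ 16 * ∑ i ∈ Y, a i ^ 2 := by
      gcongr
      exact Finset.single_le_sum (f := fun i => a i ^ 2) (fun _ _ => zero_le) hi₀

/-! ### Laminar families -/

variable {X : Type*}

/-- Any two members of the family are nested or disjoint. -/
def IsLaminar (R : Set (Set X)) : Prop :=
  ∀ I ∈ R, ∀ J ∈ R, I ⊆ J ∨ J ⊆ I ∨ Disjoint I J

lemma IsLaminar.mono {R R' : Set (Set X)} (h : IsLaminar R) (hR : R' ⊆ R) : IsLaminar R' :=
  fun I hI J hJ => h I (hR hI) J (hR hJ)

open Classical in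
-- Two members that contain `x` are nested, so each product in the expanded square is charged to the
-- pair (larger set, smaller set).
lemma IsLaminar.sq_sum_indicator_le {R : Finset (Set X)} (hR : IsLaminar (R : Set (Set X)))
    (w : Set X → ℝ≥0∞) (x : X) :
    (∑ J ∈ R, J.indicator (fun _ => w J) x) ^ 2 ≤
      2 * ∑ J ∈ R, ∑ K ∈ R with K ⊆ J, w J * K.indicator (fun _ => w K) x := by
  set t : Set X → Set X → ℝ≥0∞ := fun J K =>
    if K ⊆ J then w J * K.indicator (fun _ => w K) x else 0 with ht
  have hJK : ∀ J ∈ R, ∀ K ∈ R,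
      J.indicator (fun _ => w J) x * K.indicator (fun _ => w K) x ≤ t J K + t K J := by
    intro J hJ K hK
    by_cases hxJ : x ∈ J
    · by_cases hxK : x ∈ K
      · rcases hR J hJ K hK with h | h | h
        · refine le_add_left ?_
          simp [ht, h, hxJ, hxK, mul_comm]
        · refine le_add_right ?_
          simp [ht, h, hxJ, hxK]
        · exact absurd hxK (Set.disjoint_left.1 h hxJ)
      · simp [hxK]
    · simp [hxJ]
  calc (∑ J ∈ R, J.indicator (fun _ => w J) x) ^ 2
      = ∑ J ∈ R, ∑ K ∈ R, J.indicator (fun _ => w J) x * K.indicator (fun _ => w K) x := by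
        rw [sq, Finset.sum_mul_sum]
    _ ≤ ∑ J ∈ R, ∑ K ∈ R, (t J K + t K J) :=
        Finset.sum_le_sum fun J hJ => Finset.sum_le_sum fun K hK => hJK J hJ K hK
    _ = 2 * ∑ J ∈ R, ∑ K ∈ R, t J K := by
        simp_rw [Finset.sum_add_distrib]
        rw [Finset.sum_comm (f := fun J K => t K J), two_mul]
    _ = _ := by simp_rw [ht, Finset.sum_filter]

/-! ### Stopping families -/

section Stopping

open Classical

variable (R : Finset (Set X)) (k : Set X → ℤ)

/-- The members of `R` at which the level `k` is larger than at all strict ancestors. -/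
noncomputable def stoppingSets : Finset (Set X) :=
  R.filter fun S => ∀ I ∈ R, S ⊂ I → k I < k S

/-- The maximal members of `R` inside `S` whose level exceeds that of `S`. -/
noncomputable def stoppingChildren (S : Set X) : Finset (Set X) :=
  R.filter fun J => J ⊆ S ∧ k S < k J ∧ ∀ I ∈ R, J ⊂ I → k I ≤ k S

/-- The members of `R` inside `S` of the same level as `S`. -/
noncomputable def sameLevel (S : Set X) : Finset (Set X) :=
  R.filter fun J => J ⊆ S ∧ k J = k S

variable {R k}

lemma exists_mem_stoppingSets (hk : ∀ I ∈ R, ∀ J ∈ R, I ⊆ J → k J ≤ k I) {J : Set X}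
    (hJ : J ∈ R) : ∃ S ∈ stoppingSets R k, J ∈ sameLevel R k S := by
  -- The stopping set is a maximal ancestor of `J` of the same level.
  have hne : (R.filter fun I => J ⊆ I ∧ k I = k J).Nonempty := ⟨J, by simp [hJ]⟩
  obtain ⟨S, hS⟩ := Finset.exists_maximal hne
  have hS' := Finset.mem_filter.1 hS.1
  refine ⟨S, Finset.mem_filter.2 ⟨hS'.1, fun I hI hSI => ?_⟩,
    Finset.mem_filter.2 ⟨hJ, hS'.2.1, hS'.2.2.symm⟩⟩
  refine lt_of_le_of_ne (hk S hS'.1 I hI hSI.subset) fun h => ?_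
  have := hS.2 (y := I)
    (Finset.mem_filter.2 ⟨hI, hS'.2.1.trans hSI.subset, h.trans hS'.2.2⟩) hSI.subset
  exact hSI.2 this

lemma exists_mem_stoppingChildren (hk : ∀ I ∈ R, ∀ J ∈ R, I ⊆ J → k J ≤ k I)
    (hR : IsLaminar (R : Set (Set X))) {S J : Set X} (hS : S ∈ R) (hJ : J ∈ R) (hne : J.Nonempty)
    (hJS : J ⊆ S) (hlt : k S < k J) : ∃ S' ∈ stoppingChildren R k S, J ⊆ S' := by
  have hne' : (R.filter fun I => J ⊆ I ∧ I ⊆ S ∧ k S < k I).Nonempty :=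
    ⟨J, by simp [hJ, hJS, hlt]⟩
  obtain ⟨T, hT⟩ := Finset.exists_maximal hne'
  obtain ⟨hTR, hJT, hTS, hkT⟩ := Finset.mem_filter.1 hT.1
  refine ⟨T, Finset.mem_filter.2 ⟨hTR, hTS, hkT, fun I hI hTI => ?_⟩, hJT⟩
  rcases hR I hI S hS with h | h | h
  · by_contra! hc
    exact hTI.2 (hT.2 (y := I)
      (Finset.mem_filter.2 ⟨hI, hJT.trans hTI.subset, h, hc⟩) hTI.subset)
  · exact hk S hS I hI h
  · obtain ⟨x, hx⟩ := hne
    exact absurd (hJS hx) (Set.disjoint_left.1 h (hTI.subset (hJT hx)))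

lemma disjoint_of_mem_stoppingChildren (hR : IsLaminar (R : Set (Set X))) {S J K : Set X}
    (hJ : J ∈ stoppingChildren R k S) (hK : K ∈ stoppingChildren R k S) (hne : J ≠ K) :
    Disjoint J K := by
  obtain ⟨hJR, -, hJk, hJm⟩ := Finset.mem_filter.1 hJ
  obtain ⟨hKR, -, hKk, hKm⟩ := Finset.mem_filter.1 hK
  rcases hR J hJR K hKR with h | h | h
  · exact absurd (hJm K hKR (h.ssubset_of_ne hne)) (not_le.2 hKk)
  · exact absurd (hKm J hJR (h.ssubset_of_ne hne.symm)) (not_le.2 hJk)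
  · exact h

lemma stoppingChildren_subset_stoppingSets (S : Set X) :
    stoppingChildren R k S ⊆ stoppingSets R k := by
  intro J hJ
  obtain ⟨hJR, -, hJk, hJm⟩ := Finset.mem_filter.1 hJ
  exact Finset.mem_filter.2 ⟨hJR, fun I hI hJI => (hJm I hI hJI).trans_lt hJk⟩

/-- If `J` were a child of both, `T` would lie strictly between `J` and `S` with level above that of
`S`, against the maximality of `J` as a child of `S`. -/
lemma not_mem_stoppingChildren_of_ssubset {S T J : Set X} (hS : S ∈ R)
    (hT : T ∈ stoppingSets R k) (hTS : T ⊂ S) (hJS : J ∈ stoppingChildren R k S) :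
    J ∉ stoppingChildren R k T := by
  intro hJT
  obtain ⟨hTR, hTm⟩ := Finset.mem_filter.1 hT
  obtain ⟨-, -, -, hJm⟩ := Finset.mem_filter.1 hJS
  obtain ⟨-, hJTs, hJTk, -⟩ := Finset.mem_filter.1 hJT
  have h1 := hTm S hS hTS
  have h2 := hJm T hTR (hJTs.ssubset_of_ne fun h => by simp [h] at hJTk)
  omega

lemma pairwiseDisjoint_stoppingChildren (hR : IsLaminar (R : Set (Set X)))
    (hne : ∀ J ∈ R, J.Nonempty) :
    (stoppingSets R k : Set (Set X)).PairwiseDisjoint (stoppingChildren R k) := by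
  intro S hS T hT hST
  have hSR := (Finset.mem_filter.1 hS).1
  have hTR := (Finset.mem_filter.1 hT).1
  refine Finset.disjoint_left.2 fun J hJS hJT => ?_
  rcases hR S hSR T hTR with h | h | h
  · exact not_mem_stoppingChildren_of_ssubset hTR hS (h.ssubset_of_ne hST) hJT hJS
  · exact not_mem_stoppingChildren_of_ssubset hSR hT (h.ssubset_of_ne hST.symm) hJS hJT
  · obtain ⟨hJR, hJS', -⟩ := Finset.mem_filter.1 hJS
    obtain ⟨-, hJT', -⟩ := Finset.mem_filter.1 hJT
    obtain ⟨x, hx⟩ := hne J hJR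
    exact Set.disjoint_left.1 h (hJS' hx) (hJT' hx)

/-- A stopping set strictly inside `S` has a higher level, so it lies in a stopping child of `S`. -/
lemma disjoint_diff_stoppingChildren_of_ssubset (hk : ∀ I ∈ R, ∀ J ∈ R, I ⊆ J → k J ≤ k I)
    (hR : IsLaminar (R : Set (Set X))) (hne : ∀ J ∈ R, J.Nonempty) {S T : Set X} (hS : S ∈ R)
    (hT : T ∈ stoppingSets R k) (hTS : T ⊂ S) :
    Disjoint (S \ ⋃ J ∈ stoppingChildren R k S, J) T := by
  obtain ⟨hTR, hTm⟩ := Finset.mem_filter.1 hT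
  obtain ⟨S', hS', hTS'⟩ :=
    exists_mem_stoppingChildren hk hR hS hTR (hne T hTR) hTS.subset (hTm S hS hTS)
  exact Set.disjoint_left.2 fun x hx hxT => hx.2 (Set.mem_biUnion hS' (hTS' hxT))

lemma pairwiseDisjoint_diff_stoppingChildren (hk : ∀ I ∈ R, ∀ J ∈ R, I ⊆ J → k J ≤ k I)
    (hR : IsLaminar (R : Set (Set X))) (hne : ∀ J ∈ R, J.Nonempty) :
    (stoppingSets R k : Set (Set X)).PairwiseDisjoint
      fun S => S \ ⋃ J ∈ stoppingChildren R k S, J := by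
  intro S hS T hT hST
  have hSR := (Finset.mem_filter.1 hS).1
  have hTR := (Finset.mem_filter.1 hT).1
  rcases hR S hSR T hTR with h | h | h
  · exact ((disjoint_diff_stoppingChildren_of_ssubset hk hR hne hTR hS
      (h.ssubset_of_ne hST)).mono_right Set.sdiff_subset).symm
  · exact (disjoint_diff_stoppingChildren_of_ssubset hk hR hne hSR hT
      (h.ssubset_of_ne hST.symm)).mono_right Set.sdiff_subset
  · exact h.mono Set.sdiff_subset Set.sdiff_subset

/-- The stopping sets through a point form a chain along which the level strictly increases. -/
lemma injOn_level_stoppingSets (hR : IsLaminar (R : Set (Set X))) (x : X) :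
    Set.InjOn k ((stoppingSets R k).filter fun S => x ∈ S : Finset (Set X)) := by
  intro S hS T hT hST
  simp only [stoppingSets, Finset.coe_filter, Finset.mem_filter, Set.mem_ofPred_eq] at hS hT
  by_contra hne
  rcases hR S hS.1.1 T hT.1.1 with h | h | h
  · exact absurd hST (hS.1.2 T hT.1.1 (h.ssubset_of_ne hne)).ne'
  · exact absurd hST (hT.1.2 S hS.1.1 (h.ssubset_of_ne (Ne.symm hne))).ne
  · exact Set.disjoint_left.1 h hS.2 hT.2

/-- The level of `J` is the largest integer part of `log₂ (a I)` over the ancestors `I ⊇ J` in `R`.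
At a stopping set this maximum is attained by the set itself, whence the lower bound there. -/
lemma exists_levels (R : Finset (Set X)) {a : Set X → ℝ≥0∞} (ha0 : ∀ J ∈ R, a J ≠ 0)
    (haT : ∀ J ∈ R, a J ≠ ∞) :
    ∃ k : Set X → ℤ, (∀ I ∈ R, ∀ J ∈ R, I ⊆ J → k J ≤ k I) ∧
      (∀ J ∈ R, a J ≤ 2 ^ (k J + 1)) ∧ ∀ S ∈ stoppingSets R k, 2 ^ k S ≤ a S := by
  have h : ∀ J, ∃ n : ℤ, J ∈ R → a J ∈ Set.Ico ((2 : ℝ≥0∞) ^ n) (2 ^ (n + 1)) := by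
    intro J
    by_cases hJ : J ∈ R
    · obtain ⟨n, hn⟩ := ENNReal.exists_mem_Ico_zpow (ha0 J hJ) (haT J hJ)
        (y := 2) (by norm_num) (by norm_num)
      exact ⟨n, fun _ => hn⟩
    · exact ⟨0, fun h => absurd h hJ⟩
  choose l hl using h
  have hne : ∀ J ∈ R, (R.filter fun I => J ⊆ I).Nonempty := fun J hJ => ⟨J, by simp [hJ]⟩
  let k : Set X → ℤ := fun J =>
    if hJ : J ∈ R then (R.filter fun I => J ⊆ I).sup' (hne J hJ) l else 0
  have hk : ∀ J (hJ : J ∈ R), k J = (R.filter fun I => J ⊆ I).sup' (hne J hJ) l :=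
    fun J hJ => by simp [k, hJ]
  have hle : ∀ J ∈ R, ∀ I ∈ R, J ⊆ I → l I ≤ k J := fun J hJ I hI hJI => by
    rw [hk J hJ]
    exact Finset.le_sup' l (Finset.mem_filter.2 ⟨hI, hJI⟩)
  have hex : ∀ J ∈ R, ∃ I ∈ R, J ⊆ I ∧ k J = l I := fun J hJ => by
    obtain ⟨I, hI, h⟩ := Finset.exists_mem_eq_sup' (hne J hJ) l
    obtain ⟨hIR, hJI⟩ := Finset.mem_filter.1 hI
    exact ⟨I, hIR, hJI, (hk J hJ).trans h⟩
  refine ⟨k, ?_, ?_, ?_⟩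
  · intro I hI J hJ hIJ
    obtain ⟨K, hK, hJK, h⟩ := hex J hJ
    exact h.trans_le (hle I hI K hK (hIJ.trans hJK))
  · intro J hJ
    refine (hl J hJ).2.le.trans (ENNReal.zpow_le_of_le (by norm_num) ?_)
    have := hle J hJ J hJ subset_rfl
    omega
  · intro S hS
    obtain ⟨hSR, hSm⟩ := Finset.mem_filter.1 hS
    obtain ⟨I, hI, hSI, h⟩ := hex S hSR
    by_cases hIS : S = I
    · subst hIS
      rw [h]
      exact (hl S hSR).1
    · have h1 := hSm I hI (hSI.ssubset_of_ne hIS)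
      have h2 := hle I hI I hI subset_rfl
      omega

end Stopping

end EntropyBump

namespace EntropyBump

variable {X : Type*} [m0 : MeasurableSpace X]

/-! ### Embedding and testing for positive operators -/

section Embedding

open Classical

variable {R : Finset (Set X)} {σ ω : Measure X}

lemma lintegral_sum_indicator_mul (hm : ∀ J ∈ R, MeasurableSet J) (w : Set X → ℝ≥0∞)
    {G : X → ℝ≥0∞} (hG : Measurable G) (ν : Measure X) :
    ∫⁻ x, (∑ J ∈ R, J.indicator (fun _ => w J) x) * G x ∂ν = ∑ J ∈ R, w J * ∫⁻ x in J, G x ∂ν := by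
  simp_rw [Finset.sum_mul]
  rw [lintegral_finsetSum' _ fun J hJ =>
    ((measurable_const.indicator (hm J hJ)).fun_mul hG).aemeasurable]
  refine Finset.sum_congr rfl fun J hJ => ?_
  rw [← lintegral_const_mul _ hG, ← lintegral_indicator (hm J hJ)]
  refine lintegral_congr fun x => ?_
  by_cases hx : x ∈ J <;> simp [hx]

lemma measurable_sum_indicator (hm : ∀ J ∈ R, MeasurableSet J) (w : Set X → ℝ≥0∞) :
    Measurable fun x => ∑ J ∈ R, J.indicator (fun _ => w J) x :=
  Finset.measurable_sum _ fun J hJ => measurable_const.indicator (hm J hJ)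

lemma le_two_mul_of_le_add_half {x y : ℝ≥0∞} (hx : x ≠ ∞) (h : x ≤ y + x / 2) : x ≤ 2 * y := by
  have h1 : x / 2 + x / 2 ≤ y + x / 2 := by rwa [ENNReal.add_halves]
  have h2 : x / 2 ≤ y :=
    (ENNReal.add_le_add_iff_right (ENNReal.div_ne_top hx (by norm_num))).1 h1
  calc x = x / 2 + x / 2 := (ENNReal.add_halves x).symm
    _ ≤ y + y := add_le_add h2 h2
    _ = 2 * y := (two_mul y).symm

/-- Carleson embedding for a family on which the averages grow geometrically. -/
lemma sum_sq_average_stoppingSets_le (hm : ∀ J ∈ R, MeasurableSet J)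
    (hR : IsLaminar (R : Set (Set X))) (hσT : ∀ J ∈ R, σ J ≠ ∞)
    {F : X → ℝ≥0∞} (hF : Measurable F) {a : Set X → ℝ≥0∞}
    (ha : ∀ J ∈ R, a J * σ J = ∫⁻ x in J, F x ∂σ) (haT : ∀ J ∈ R, a J ≠ ∞)
    {k : Set X → ℤ} (hak : ∀ J ∈ R, a J ≤ 2 ^ (k J + 1))
    (hka : ∀ S ∈ stoppingSets R k, 2 ^ k S ≤ a S) :
    ∑ S ∈ stoppingSets R k, a S ^ 2 * σ S ≤ 16 * ∫⁻ x, F x ^ 2 ∂σ := by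
  set W := stoppingSets R k with hW
  have hWR : W ⊆ R := Finset.filter_subset _ _
  have hWm : ∀ J ∈ W, MeasurableSet J := fun J hJ => hm J (hWR hJ)
  -- Finiteness permits this sum to be subtracted from both sides at the end.
  have hT : ∑ S ∈ W, a S ^ 2 * σ S ≠ ∞ := by
    refine (ENNReal.sum_lt_top.2 fun S hS => ?_).ne
    exact ENNReal.mul_lt_top (ENNReal.pow_lt_top (haT S (hWR hS)).lt_top)
      (hσT S (hWR hS)).lt_top
  set h : X → ℝ≥0∞ := fun x => ∑ J ∈ W, J.indicator (fun _ => a J) x with hh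
  have hhm : Measurable h := measurable_sum_indicator hWm a
  have hsq : ∀ x, h x ^ 2 ≤ 16 * ∑ J ∈ W, J.indicator (fun _ => a J ^ 2) x := by
    intro x
    have := sq_sum_le_of_injOn (W.filter fun S => x ∈ S) k (injOn_level_stoppingSets hR x) a
      (fun S hS => hka S (Finset.mem_filter.1 hS).1)
      (fun S hS => hak S (hWR (Finset.mem_filter.1 hS).1))
    simpa [hh, Finset.sum_filter, Set.indicator_apply] using this
  have hint : ∫⁻ x, h x ^ 2 ∂σ ≤ 16 * ∑ S ∈ W, a S ^ 2 * σ S := by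
    calc ∫⁻ x, h x ^ 2 ∂σ ≤ ∫⁻ x, 16 * ∑ J ∈ W, J.indicator (fun _ => a J ^ 2) x ∂σ :=
          lintegral_mono hsq
      _ = 16 * ∫⁻ x, (∑ J ∈ W, J.indicator (fun _ => a J ^ 2) x) * 1 ∂σ := by
          simp_rw [mul_one]
          rw [lintegral_const_mul _ (measurable_sum_indicator hWm fun J => a J ^ 2)]
      _ = _ := by
          rw [lintegral_sum_indicator_mul hWm (fun J => a J ^ 2) measurable_const]
          simp
  have hmain : 2 * ∑ S ∈ W, a S ^ 2 * σ S ≤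
      16 * ∫⁻ x, F x ^ 2 ∂σ + ∑ S ∈ W, a S ^ 2 * σ S := by
    calc 2 * ∑ S ∈ W, a S ^ 2 * σ S = 2 * ∑ S ∈ W, a S * ∫⁻ x in S, F x ∂σ := by
          congr 1
          refine Finset.sum_congr rfl fun S hS => ?_
          rw [← ha S (hWR hS)]
          ring
      _ = ∫⁻ x, 2 * (h x * F x) ∂σ := by
          rw [← lintegral_sum_indicator_mul hWm a hF,
            lintegral_const_mul _ (hhm.fun_mul hF)]
      -- The weight 16 cancels the constant of `hint`, leaving one copy of the sum against two on
      -- the left.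
      _ ≤ ∫⁻ x, (((16 : ℝ≥0) : ℝ≥0∞)⁻¹ * h x ^ 2 + (16 : ℝ≥0) * F x ^ 2) ∂σ :=
          lintegral_mono fun x => two_mul_mul_le_add_sq_inv _ _ (by norm_num)
      _ = (16 : ℝ≥0∞)⁻¹ * ∫⁻ x, h x ^ 2 ∂σ + 16 * ∫⁻ x, F x ^ 2 ∂σ := by
          rw [lintegral_add_right _ ((hF.pow_const 2).const_mul _),
            lintegral_const_mul _ (hF.pow_const 2),
            lintegral_const_mul _ (hhm.pow_const 2)]
          norm_num
      _ ≤ (16 : ℝ≥0∞)⁻¹ * (16 * ∑ S ∈ W, a S ^ 2 * σ S) + 16 * ∫⁻ x, F x ^ 2 ∂σ := by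
          gcongr
      _ = _ := by
          rw [← mul_assoc, ENNReal.inv_mul_cancel (by norm_num) (by norm_num), one_mul, add_comm]
  rw [two_mul] at hmain
  exact (ENNReal.add_le_add_iff_right hT).1 hmain

/-- `G` with its values on the stopping children of `S` replaced by `b`, and set to `0` off `S`. -/
noncomputable def stoppingProjection (R : Finset (Set X)) (k : Set X → ℤ) (b : Set X → ℝ≥0∞)
    (G : X → ℝ≥0∞) (S : Set X) (x : X) : ℝ≥0∞ :=
  (S \ ⋃ J ∈ stoppingChildren R k S, J).indicator G x +
    ∑ J ∈ stoppingChildren R k S, J.indicator (fun _ => b J) x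

lemma measurableSet_diff_stoppingChildren (hm : ∀ J ∈ R, MeasurableSet J) {S : Set X} (hS : S ∈ R)
    (k : Set X → ℤ) : MeasurableSet (S \ ⋃ J ∈ stoppingChildren R k S, J) :=
  (hm S hS).diff (Finset.measurableSet_biUnion _ fun J hJ => hm J (Finset.mem_filter.1 hJ).1)

lemma measurable_stoppingProjection (hm : ∀ J ∈ R, MeasurableSet J) {S : Set X} (hS : S ∈ R)
    (k : Set X → ℤ) (b : Set X → ℝ≥0∞) {G : X → ℝ≥0∞} (hG : Measurable G) :
    Measurable (stoppingProjection R k b G S) :=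
  (hG.indicator (measurableSet_diff_stoppingChildren hm hS k)).add
    (measurable_sum_indicator (fun J hJ => hm J (Finset.mem_filter.1 hJ).1) b)

/-- The children are disjoint from one another and from the remainder, so squaring produces no cross
terms. -/
lemma lintegral_sq_stoppingProjection_le (hm : ∀ J ∈ R, MeasurableSet J)
    (hR : IsLaminar (R : Set (Set X))) {S : Set X} (hS : S ∈ R) (k : Set X → ℤ)
    (b : Set X → ℝ≥0∞) {G : X → ℝ≥0∞} (hG : Measurable G) :
    ∫⁻ x, stoppingProjection R k b G S x ^ 2 ∂ω ≤
      ∫⁻ x in S \ ⋃ J ∈ stoppingChildren R k S, J, G x ^ 2 ∂ω +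
        ∑ J ∈ stoppingChildren R k S, b J ^ 2 * ω J := by
  have hcm : ∀ J ∈ stoppingChildren R k S, MeasurableSet J :=
    fun J hJ => hm J (Finset.mem_filter.1 hJ).1
  have hE := measurableSet_diff_stoppingChildren hm hS k
  set E := S \ ⋃ J ∈ stoppingChildren R k S, J with hEdef
  have hpt : ∀ x, stoppingProjection R k b G S x ^ 2 ≤ E.indicator (fun y => G y ^ 2) x +
      ∑ J ∈ stoppingChildren R k S, J.indicator (fun _ => b J ^ 2) x := by
    intro x
    by_cases hx : ∃ J ∈ stoppingChildren R k S, x ∈ J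
    · obtain ⟨J, hJ, hxJ⟩ := hx
      have hxE : x ∉ E := fun h => h.2 (Set.mem_biUnion hJ hxJ)
      have hsum : ∑ K ∈ stoppingChildren R k S, K.indicator (fun _ => b K) x = b J := by
        rw [Finset.sum_eq_single J, Set.indicator_of_mem hxJ]
        · intro K hK hKJ
          exact Set.indicator_of_notMem
            (Set.disjoint_left.1 (disjoint_of_mem_stoppingChildren hR hJ hK hKJ.symm) hxJ) _
        · exact fun h => absurd hJ h
      rw [stoppingProjection, ← hEdef, Set.indicator_of_notMem hxE, hsum, zero_add]
      refine le_add_left ?_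
      refine le_trans ?_ (Finset.single_le_sum
        (f := fun K => K.indicator (fun _ => b K ^ 2) x) (fun _ _ => zero_le) hJ)
      simp [hxJ]
    · push Not at hx
      have hsum : ∑ K ∈ stoppingChildren R k S, K.indicator (fun _ => b K) x = 0 :=
        Finset.sum_eq_zero fun K hK => Set.indicator_of_notMem (hx K hK) _
      rw [stoppingProjection, ← hEdef, hsum, add_zero]
      refine le_add_right ?_
      by_cases hxE : x ∈ E <;> simp [hxE]
  refine (lintegral_mono hpt).trans_eq ?_
  rw [lintegral_add_left ((hG.pow_const 2).indicator hE), lintegral_indicator hE]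
  congr 1
  have := lintegral_sum_indicator_mul hcm (fun J => b J ^ 2) (G := fun _ => 1) measurable_const ω
  simpa using this

/-- A child of `S` that meets `J` lies inside `J`: containing `J` would force its level down to that
of `S`. Averaging `G` over it therefore preserves its contribution to the integral over `J`. -/
lemma setLIntegral_le_stoppingProjection {k : Set X → ℤ} (hm : ∀ J ∈ R, MeasurableSet J)
    (hk : ∀ I ∈ R, ∀ J ∈ R, I ⊆ J → k J ≤ k I)
    (hR : IsLaminar (R : Set (Set X))) {S : Set X} (hS : S ∈ R)
    {b : Set X → ℝ≥0∞} {G : X → ℝ≥0∞} (hG : Measurable G)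
    (hb : ∀ J ∈ R, b J * ω J = ∫⁻ x in J, G x ∂ω) {J : Set X} (hJ : J ∈ sameLevel R k S) :
    ∫⁻ x in J, G x ∂ω ≤ ∫⁻ x in J, stoppingProjection R k b G S x ∂ω := by
  obtain ⟨hJR, hJS, hJk⟩ := Finset.mem_filter.1 hJ
  have hcm : ∀ J ∈ stoppingChildren R k S, MeasurableSet J :=
    fun J hJ => hm J (Finset.mem_filter.1 hJ).1
  have hE := measurableSet_diff_stoppingChildren hm hS k
  have hJm := hm J hJR
  set E := S \ ⋃ J ∈ stoppingChildren R k S, J with hEdef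
  have hchild : ∀ K ∈ stoppingChildren R k S,
      ∫⁻ x in J, K.indicator G x ∂ω ≤ ∫⁻ x in J, K.indicator (fun _ => b K) x ∂ω := by
    intro K hK
    obtain ⟨hKR, hKS, hKk, -⟩ := Finset.mem_filter.1 hK
    have hKm := hm K hKR
    rw [lintegral_indicator hKm, lintegral_indicator hKm, Measure.restrict_restrict hKm]
    rcases hR K hKR J hJR with h | h | h
    · rw [Set.inter_eq_left.2 h, setLIntegral_const, hb K hKR]
    · have := hk J hJR K hKR h
      omega
    · simp [h.inter_eq]
  calc ∫⁻ x in J, G x ∂ω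
      ≤ ∫⁻ x in J, (E.indicator G x + ∑ K ∈ stoppingChildren R k S, K.indicator G x) ∂ω := by
        refine setLIntegral_mono_ae' hJm (.of_forall fun x hxJ => ?_)
        by_cases hx : ∃ K ∈ stoppingChildren R k S, x ∈ K
        · obtain ⟨K, hK, hxK⟩ := hx
          refine le_add_left ?_
          refine le_trans ?_ (Finset.single_le_sum
            (f := fun K : Set X => K.indicator G x) (fun _ _ => zero_le) hK)
          simp [hxK]
        · have hxE : x ∈ E := ⟨hJS hxJ, by simpa using hx⟩
          simp [hxE]
    _ = ∫⁻ x in J, E.indicator G x ∂ω +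
          ∑ K ∈ stoppingChildren R k S, ∫⁻ x in J, K.indicator G x ∂ω := by
        rw [lintegral_add_left (hG.indicator hE),
          lintegral_finsetSum' _ fun K hK => (hG.indicator (hcm K hK)).aemeasurable]
    _ ≤ ∫⁻ x in J, E.indicator G x ∂ω +
          ∑ K ∈ stoppingChildren R k S, ∫⁻ x in J, K.indicator (fun _ => b K) x ∂ω := by
        exact add_le_add_right (Finset.sum_le_sum hchild) _
    _ = _ := by
        simp only [stoppingProjection]
        rw [lintegral_add_left (hG.indicator hE), lintegral_finsetSum' _
          fun K hK => (measurable_const.indicator (hcm K hK)).aemeasurable]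

/-- One half of the two weight theorem for positive operators: over the sets on which the averages
of `F` dominate those of `G`, the testing condition for `σ` alone controls the bilinear form. -/
theorem sum_average_mul_le_of_testing (hm : ∀ J ∈ R, MeasurableSet J)
    (hR : IsLaminar (R : Set (Set X))) (hσ0 : ∀ J ∈ R, σ J ≠ 0) (hσT : ∀ J ∈ R, σ J ≠ ∞)
    {F G : X → ℝ≥0∞} (hF : Measurable F) (hG : Measurable G) {a b : Set X → ℝ≥0∞}
    (ha : ∀ J ∈ R, a J * σ J = ∫⁻ x in J, F x ∂σ) (ha0 : ∀ J ∈ R, a J ≠ 0)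
    (haT : ∀ J ∈ R, a J ≠ ∞)
    (hb : ∀ J ∈ R, b J * ω J = ∫⁻ x in J, G x ∂ω)
    (hba : ∀ J ∈ R, b J ^ 2 * ω J ≤ a J ^ 2 * σ J)
    (w : Set X → ℝ≥0∞) {κ : ℝ≥0} (hκ : κ ≠ 0)
    (htest : ∀ I ∈ R,
      ∫⁻ x, (∑ J ∈ R with J ⊆ I, J.indicator (fun _ => w J) x) ^ 2 ∂ω ≤ κ ^ 2 * σ I) :
    ∑ J ∈ R, a J * (w J * ∫⁻ x in J, G x ∂ω) ≤
      32 * κ * (∫⁻ x, F x ^ 2 ∂σ + ∫⁻ x, G x ^ 2 ∂ω) := by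
  obtain ⟨k, hk, hak, hka⟩ := exists_levels R ha0 haT
  have hne : ∀ J ∈ R, J.Nonempty := fun J hJ => nonempty_of_measure_ne_zero (hσ0 J hJ)
  have hcarl := sum_sq_average_stoppingSets_le hm hR hσT hF ha haT hak hka
  set W := stoppingSets R k with hW
  have hWR : W ⊆ R := Finset.filter_subset _ _
  have hS : ∀ S ∈ W, ∑ J ∈ sameLevel R k S, a J * (w J * ∫⁻ x in J, G x ∂ω) ≤
      κ * (a S ^ 2 * σ S + (∫⁻ x in S \ ⋃ J ∈ stoppingChildren R k S, J, G x ^ 2 ∂ω +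
        ∑ J ∈ stoppingChildren R k S, a J ^ 2 * σ J)) := by
    intro S hSW
    have hSR := hWR hSW
    have hLR : sameLevel R k S ⊆ R := Finset.filter_subset _ _
    have hLm : ∀ J ∈ sameLevel R k S, MeasurableSet J := fun J hJ => hm J (hLR hJ)
    have hP := measurable_stoppingProjection hm hSR k b hG
    set P := stoppingProjection R k b G S with hPdef
    set h : X → ℝ≥0∞ := fun x => ∑ J ∈ sameLevel R k S, J.indicator (fun _ => w J) x with hh
    have hhm : Measurable h := measurable_sum_indicator hLm w
    have hhle : ∫⁻ x, h x ^ 2 ∂ω ≤ κ ^ 2 * σ S := by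
      refine le_trans (lintegral_mono fun x => ?_) (htest S hSR)
      have : sameLevel R k S ⊆ R.filter fun J => J ⊆ S := by
        intro J hJ
        obtain ⟨h1, h2, -⟩ := Finset.mem_filter.1 hJ
        exact Finset.mem_filter.2 ⟨h1, h2⟩
      exact pow_le_pow_left' (Finset.sum_le_sum_of_subset this) 2
    calc ∑ J ∈ sameLevel R k S, a J * (w J * ∫⁻ x in J, G x ∂ω)
        ≤ ∑ J ∈ sameLevel R k S, (2 * a S) * (w J * ∫⁻ x in J, P x ∂ω) := by
          refine Finset.sum_le_sum fun J hJ => ?_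
          have h1 : a J ≤ 2 * a S := by
            refine (hak J (hLR hJ)).trans ?_
            rw [(Finset.mem_filter.1 hJ).2.2, ENNReal.zpow_add (by norm_num) (by norm_num),
              zpow_one, mul_comm]
            gcongr
            exact hka S hSW
          exact mul_le_mul' h1 (mul_le_mul_right
            (setLIntegral_le_stoppingProjection hm hk hR hSR hG hb hJ) _)
      _ = ∫⁻ x, 2 * ((a S * h x) * P x) ∂ω := by
          rw [← Finset.mul_sum, ← lintegral_sum_indicator_mul hLm w hP,
            ← lintegral_const_mul _ (hhm.fun_mul hP)]
          refine lintegral_congr fun x => ?_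
          simp only [hh]
          ring
      -- The weight `κ` balances the two parts, since testing bounds the first integral by `κ ^ 2`.
      _ ≤ ∫⁻ x, ((κ : ℝ≥0∞)⁻¹ * (a S * h x) ^ 2 + κ * P x ^ 2) ∂ω :=
          lintegral_mono fun x => two_mul_mul_le_add_sq_inv _ _ hκ
      _ = (κ : ℝ≥0∞)⁻¹ * (a S ^ 2 * ∫⁻ x, h x ^ 2 ∂ω) + κ * ∫⁻ x, P x ^ 2 ∂ω := by
          rw [lintegral_add_right _ ((hP.pow_const 2).const_mul _),
            lintegral_const_mul _ (hP.pow_const 2), ← lintegral_const_mul _ (hhm.pow_const 2),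
            ← lintegral_const_mul _ ((hhm.pow_const 2).const_mul _)]
          simp_rw [mul_pow]
      _ ≤ (κ : ℝ≥0∞)⁻¹ * (a S ^ 2 * (κ ^ 2 * σ S)) +
            κ * (∫⁻ x in S \ ⋃ J ∈ stoppingChildren R k S, J, G x ^ 2 ∂ω +
              ∑ J ∈ stoppingChildren R k S, b J ^ 2 * ω J) := by
          gcongr
          exact lintegral_sq_stoppingProjection_le hm hR hSR k b hG
      _ ≤ (κ : ℝ≥0∞)⁻¹ * (a S ^ 2 * (κ ^ 2 * σ S)) +
            κ * (∫⁻ x in S \ ⋃ J ∈ stoppingChildren R k S, J, G x ^ 2 ∂ω +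
              ∑ J ∈ stoppingChildren R k S, a J ^ 2 * σ J) := by
          -- Here the domination of `F` replaces the testing condition for `ω`.
          have hbs : ∑ J ∈ stoppingChildren R k S, b J ^ 2 * ω J ≤
              ∑ J ∈ stoppingChildren R k S, a J ^ 2 * σ J :=
            Finset.sum_le_sum fun J hJ => hba J (Finset.mem_filter.1 hJ).1
          exact add_le_add_right (mul_le_mul_right (add_le_add_right hbs _) _) _
      _ = _ := by
          rw [mul_add (κ : ℝ≥0∞) (a S ^ 2 * σ S)]
          congr 1
          calc (κ : ℝ≥0∞)⁻¹ * (a S ^ 2 * (κ ^ 2 * σ S))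
              = ((κ : ℝ≥0∞)⁻¹ * κ) * (κ * (a S ^ 2 * σ S)) := by ring
            _ = _ := by
              rw [ENNReal.inv_mul_cancel (by exact_mod_cast hκ) ENNReal.coe_ne_top, one_mul]
  have hGsum : ∑ S ∈ W, ∫⁻ x in S \ ⋃ J ∈ stoppingChildren R k S, J, G x ^ 2 ∂ω ≤
      ∫⁻ x, G x ^ 2 ∂ω := by
    rw [← lintegral_biUnion_finset (pairwiseDisjoint_diff_stoppingChildren hk hR hne)
      fun S hS => measurableSet_diff_stoppingChildren hm (hWR hS) k]
    exact setLIntegral_le_lintegral _ _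
  have hchsum : ∑ S ∈ W, ∑ J ∈ stoppingChildren R k S, a J ^ 2 * σ J ≤
      ∑ S ∈ W, a S ^ 2 * σ S := by
    rw [← Finset.sum_biUnion (pairwiseDisjoint_stoppingChildren hR hne)]
    exact Finset.sum_le_sum_of_subset
      (Finset.biUnion_subset.2 fun S _ => stoppingChildren_subset_stoppingSets S)
  calc ∑ J ∈ R, a J * (w J * ∫⁻ x in J, G x ∂ω)
      ≤ ∑ J ∈ R, ∑ S ∈ W, if J ⊆ S ∧ k J = k S then a J * (w J * ∫⁻ x in J, G x ∂ω) else 0 := by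
        refine Finset.sum_le_sum fun J hJ => ?_
        obtain ⟨S, hSW, hJS⟩ := exists_mem_stoppingSets hk hJ
        refine le_trans (le_of_eq ?_) (Finset.single_le_sum (f := fun S =>
          if J ⊆ S ∧ k J = k S then a J * (w J * ∫⁻ x in J, G x ∂ω) else 0)
          (fun _ _ => zero_le) hSW)
        exact (if_pos (Finset.mem_filter.1 hJS).2).symm
    _ = ∑ S ∈ W, ∑ J ∈ sameLevel R k S, a J * (w J * ∫⁻ x in J, G x ∂ω) := by
        rw [Finset.sum_comm]
        simp_rw [sameLevel, Finset.sum_filter]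
    _ ≤ ∑ S ∈ W, κ * (a S ^ 2 * σ S + (∫⁻ x in S \ ⋃ J ∈ stoppingChildren R k S, J, G x ^ 2 ∂ω +
          ∑ J ∈ stoppingChildren R k S, a J ^ 2 * σ J)) := Finset.sum_le_sum hS
    _ ≤ κ * (16 * ∫⁻ x, F x ^ 2 ∂σ + (∫⁻ x, G x ^ 2 ∂ω + 16 * ∫⁻ x, F x ^ 2 ∂σ)) := by
        rw [← Finset.mul_sum, Finset.sum_add_distrib, Finset.sum_add_distrib]
        gcongr
        exact hchsum.trans hcarl
    -- Only to give both integrals the common constant 32 = 16 + 16.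
    _ ≤ κ * (16 * ∫⁻ x, F x ^ 2 ∂σ + (32 * ∫⁻ x, G x ^ 2 ∂ω + 16 * ∫⁻ x, F x ^ 2 ∂σ)) := by
        gcongr
        exact le_mul_of_one_le_left zero_le (by norm_num)
    _ = _ := by ring

end Embedding

end EntropyBump

namespace EntropyBump

variable {X : Type*} [m0 : MeasurableSpace X]

/-! ### Sparse families -/

namespace AtomicFiltration

variable {μ : Measure X} (𝓕 : AtomicFiltration μ)

/-- An atom of a coarser generation is a union of atoms of the finer one; a given finer atom is one
of these or disjoint from all of them. -/
lemma isLaminar_lattice : IsLaminar 𝓕.lattice := by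
  have key : ∀ n m, n ≤ m → ∀ I ∈ 𝓕.atoms n, ∀ J ∈ 𝓕.atoms m, J ⊆ I ∨ Disjoint I J := by
    intro n m hnm I hI J hJ
    obtain ⟨S, hS, rfl⟩ := 𝓕.exists_eq_sUnion m I
      (𝓕.filtration.mono hnm _ (𝓕.measurableSet_atom n I hI))
    by_cases hJS : J ∈ S
    · exact Or.inl (Set.subset_sUnion_of_mem hJS)
    · refine Or.inr (Set.disjoint_sUnion_left.2 fun K hK => ?_)
      exact 𝓕.pairwiseDisjoint_atoms m (hS hK) hJ fun h => hJS (h ▸ hK)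
  intro I hI J hJ
  obtain ⟨n, hn⟩ := Set.mem_iUnion.1 hI
  obtain ⟨m, hm⟩ := Set.mem_iUnion.1 hJ
  rcases le_total n m with h | h
  · exact Or.inr (key n m h I hn J hm)
  · rcases key m n h J hm I hn with h | h
    · exact Or.inl h
    · exact Or.inr (Or.inr h.symm)

lemma countable_lattice : 𝓕.lattice.Countable := Set.countable_iUnion 𝓕.countable_atoms

variable {𝓕}

lemma measurableSet_of_mem_lattice {I : Set X} (hI : I ∈ 𝓕.lattice) : MeasurableSet I := by
  obtain ⟨n, hn⟩ := Set.mem_iUnion.1 hI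
  exact 𝓕.filtration.le n _ (𝓕.measurableSet_atom n I hn)

lemma measure_ne_zero_of_mem_lattice {I : Set X} (hI : I ∈ 𝓕.lattice) : μ I ≠ 0 := by
  obtain ⟨n, hn⟩ := Set.mem_iUnion.1 hI
  exact (𝓕.measure_atom_pos n I hn).ne'

lemma measure_ne_top_of_mem_lattice {I : Set X} (hI : I ∈ 𝓕.lattice) : μ I ≠ ∞ := by
  obtain ⟨n, hn⟩ := Set.mem_iUnion.1 hI
  exact (𝓕.measure_atom_lt_top n I hn).ne

lemma IsSparse.mono {Q Q' : Set (Set X)} (hQ : 𝓕.IsSparse Q) (h : Q' ⊆ Q) : 𝓕.IsSparse Q' where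
  subset_lattice := h.trans hQ.subset_lattice
  measure_le I hI := by
    refine le_trans (measure_mono (Set.sUnion_subset_sUnion ?_)) (hQ.measure_le I (h hI))
    exact fun J hJ => ⟨h hJ.1, hJ.2⟩

open Classical in
/-- The parts `J \ ⋃ {K ∈ R, K ⊊ J}` of a sparse family are disjoint and carry half the measure. -/
lemma IsSparse.sum_mul_measure_le {R : Finset (Set X)} (hR : 𝓕.IsSparse (R : Set (Set X)))
    (c : Set X → ℝ≥0∞) (φ : X → ℝ≥0∞) {I : Set X}
    (hc : ∀ J ∈ R, J ⊆ I → ∀ x ∈ J, c J ≤ φ x) :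
    ∑ J ∈ R with J ⊆ I, c J * μ J ≤ 2 * ∫⁻ x in I, φ x ∂μ := by
  set E : Set X → Set X := fun J => J \ ⋃₀ {K | K ∈ (R : Set (Set X)) ∧ K ⊂ J} with hE
  have hlat : ∀ J ∈ R, J ∈ 𝓕.lattice := fun J hJ => hR.subset_lattice hJ
  have hEm : ∀ J ∈ R, MeasurableSet (E J) := fun J hJ => by
    refine (measurableSet_of_mem_lattice (hlat J hJ)).diff (Set.Finite.measurableSet_sUnion
      (R.finite_toSet.subset fun K hK => hK.1) fun K hK => ?_)
    exact measurableSet_of_mem_lattice (hlat K hK.1)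
  have hEμ : ∀ J ∈ R, μ J ≤ 2 * μ (E J) := fun J hJ => by
    refine le_two_mul_of_le_add_half (measure_ne_top_of_mem_lattice (hlat J hJ)) ?_
    calc μ J ≤ μ (E J ∪ ⋃₀ {K | K ∈ (R : Set (Set X)) ∧ K ⊂ J}) := by
          refine measure_mono fun x hx => ?_
          by_cases h : x ∈ ⋃₀ {K | K ∈ (R : Set (Set X)) ∧ K ⊂ J}
          · exact Or.inr h
          · exact Or.inl ⟨hx, h⟩
      _ ≤ μ (E J) + μ (⋃₀ {K | K ∈ (R : Set (Set X)) ∧ K ⊂ J}) := measure_union_le _ _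
      _ ≤ μ (E J) + μ J / 2 := by
          gcongr
          exact hR.measure_le J hJ
  have hEd : (R.filter (· ⊆ I) : Set (Set X)).PairwiseDisjoint E := by
    intro J hJ K hK hJK
    have hJR := (Finset.mem_filter.1 hJ).1
    have hKR := (Finset.mem_filter.1 hK).1
    rcases 𝓕.isLaminar_lattice J (hlat J hJR) K (hlat K hKR) with h | h | h
    · exact Set.disjoint_left.2 fun x hx hx' => hx'.2 ⟨J, ⟨hJR, h.ssubset_of_ne hJK⟩, hx.1⟩
    · exact Set.disjoint_left.2 fun x hx hx' => hx.2 ⟨K, ⟨hKR, h.ssubset_of_ne hJK.symm⟩, hx'.1⟩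
    · exact h.mono Set.sdiff_subset Set.sdiff_subset
  calc ∑ J ∈ R with J ⊆ I, c J * μ J ≤ ∑ J ∈ R with J ⊆ I, 2 * ∫⁻ x in E J, φ x ∂μ := by
        refine Finset.sum_le_sum fun J hJ => ?_
        obtain ⟨hJR, hJI⟩ := Finset.mem_filter.1 hJ
        calc c J * μ J ≤ c J * (2 * μ (E J)) := by
              gcongr
              exact hEμ J hJR
          _ = 2 * ∫⁻ _ in E J, c J ∂μ := by
              rw [setLIntegral_const]
              ring
          _ ≤ 2 * ∫⁻ x in E J, φ x ∂μ := mul_le_mul_right (setLIntegral_mono_ae' (hEm J hJR)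
              (.of_forall fun x hx => hc J hJR hJI x hx.1)) _
    _ = 2 * ∫⁻ x in ⋃ J ∈ R.filter (· ⊆ I), E J, φ x ∂μ := by
        rw [← Finset.mul_sum, lintegral_biUnion_finset hEd
          fun J hJ => hEm J (Finset.mem_filter.1 hJ).1]
    _ ≤ 2 * ∫⁻ x in I, φ x ∂μ := by
        gcongr
        exact Set.iUnion₂_subset fun J hJ =>
          Set.sdiff_subset.trans (Finset.mem_filter.1 hJ).2

open Classical in
lemma IsSparse.sum_measure_le {R : Finset (Set X)} (hR : 𝓕.IsSparse (R : Set (Set X)))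
    (I : Set X) : ∑ J ∈ R with J ⊆ I, μ J ≤ 2 * μ I := by
  simpa using hR.sum_mul_measure_le (fun _ => 1) (fun _ => 1) (I := I) (by simp)

lemma avg_mul_measure (u : X → ℝ≥0) {J : Set X} (hJ : J ∈ 𝓕.lattice) :
    𝓕.avg u J * μ J = ∫⁻ x in J, (u x : ℝ≥0∞) ∂μ := by
  rw [avg, setLAverage_eq, ENNReal.div_mul_cancel (measure_ne_zero_of_mem_lattice hJ)
    (measure_ne_top_of_mem_lattice hJ)]

lemma avg_le_maximal (u : X → ℝ≥0) {I J : Set X} (hJ : J ∈ 𝓕.lattice) (hJI : J ⊆ I) {x : X}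
    (hx : x ∈ J) : 𝓕.avg u J ≤ 𝓕.maximal (I.indicator fun y => (u y : ℝ≥0∞)) x := by
  have h : 𝓕.avg u J = ⨍⁻ y in J, I.indicator (fun y => (u y : ℝ≥0∞)) y ∂μ := by
    rw [avg, setLAverage_eq, setLAverage_eq]
    congr 1
    refine setLIntegral_congr_fun (measurableSet_of_mem_lattice hJ) fun y hy => ?_
    simp [hJI hy]
  rw [h]
  exact le_iSup_of_le J (le_iSup_of_le hJ (le_iSup_of_le hx le_rfl))

lemma entropyAvg_mul_measure (u : X → ℝ≥0) {I : Set X} (hI : I ∈ 𝓕.lattice) :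
    𝓕.entropyAvg u I * μ I =
      ∫⁻ x in I, 𝓕.maximal (I.indicator fun y => (u y : ℝ≥0∞)) x ∂μ := by
  rw [entropyAvg, setLAverage_eq, ENNReal.div_mul_cancel (measure_ne_zero_of_mem_lattice hI)
    (measure_ne_top_of_mem_lattice hI)]

lemma avg_le_entropyAvg (u : X → ℝ≥0) {I : Set X} (hI : I ∈ 𝓕.lattice) :
    𝓕.avg u I ≤ 𝓕.entropyAvg u I := by
  refine (ENNReal.mul_le_mul_iff_left (measure_ne_zero_of_mem_lattice hI)
    (measure_ne_top_of_mem_lattice hI)).1 ?_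
  rw [entropyAvg_mul_measure u hI, ← setLIntegral_const]
  exact setLIntegral_mono_ae' (measurableSet_of_mem_lattice hI)
    (.of_forall fun x hx => avg_le_maximal u hI subset_rfl hx)

open Classical in
-- The point where the entropy average enters: on `J ⊆ I` the average of `u` is at most the maximal
-- function of `𝟏_I u`.
lemma IsSparse.sum_setLIntegral_le {R : Finset (Set X)} (hR : 𝓕.IsSparse (R : Set (Set X)))
    (u : X → ℝ≥0) {I : Set X} (hI : I ∈ 𝓕.lattice) :
    ∑ J ∈ R with J ⊆ I, ∫⁻ x in J, (u x : ℝ≥0∞) ∂μ ≤ 2 * (𝓕.entropyAvg u I * μ I) := by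
  rw [entropyAvg_mul_measure u hI]
  refine le_trans (le_of_eq ?_) (hR.sum_mul_measure_le (𝓕.avg u) _
    fun J hJ hJI x hx => avg_le_maximal u (hR.subset_lattice hJ) hJI hx)
  exact Finset.sum_congr rfl fun J hJ =>
    (avg_mul_measure u (hR.subset_lattice (Finset.mem_filter.1 hJ).1)).symm

open Classical in
/-- The testing condition for a sparse family on which the two weight characteristic is at most `c`
and the ratio of the entropy average to the average is at most `D`. -/
lemma IsSparse.testing {R : Finset (Set X)} (hR : 𝓕.IsSparse (R : Set (Set X)))
    (u v : X → ℝ≥0) {c D : ℝ≥0∞} (hc : ∀ J ∈ R, 𝓕.avg u J * 𝓕.avg v J ≤ c)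
    (hD : ∀ J ∈ R, 𝓕.entropyAvg u J ≤ D * 𝓕.avg u J) {I : Set X} (hI : I ∈ R) :
    ∫⁻ x, (∑ J ∈ R with J ⊆ I, J.indicator (fun _ => 𝓕.avg u J) x) ^ 2
        ∂(μ.withDensity fun x => (v x : ℝ≥0∞)) ≤
      8 * c * D * (μ.withDensity fun x => (u x : ℝ≥0∞)) I := by
  have hlat : ∀ J ∈ R, J ∈ 𝓕.lattice := fun J hJ => hR.subset_lattice hJ
  set ω := μ.withDensity fun x => (v x : ℝ≥0∞) with hω
  set R' := R.filter (· ⊆ I) with hR'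
  have hR'R : R' ⊆ R := Finset.filter_subset _ _
  have hm : ∀ J ∈ R', MeasurableSet J :=
    fun J hJ => measurableSet_of_mem_lattice (hlat J (hR'R hJ))
  have hlam : IsLaminar (R' : Set (Set X)) :=
    𝓕.isLaminar_lattice.mono fun J hJ => hlat J (hR'R hJ)
  have hωJ : ∀ J ∈ R', ω J = 𝓕.avg v J * μ J := fun J hJ => by
    rw [avg_mul_measure v (hlat J (hR'R hJ)), withDensity_apply _ (hm J hJ)]
  calc ∫⁻ x, (∑ J ∈ R', J.indicator (fun _ => 𝓕.avg u J) x) ^ 2 ∂ω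
      ≤ ∫⁻ x, 2 * ∑ J ∈ R', ∑ K ∈ R' with K ⊆ J,
          𝓕.avg u J * K.indicator (fun _ => 𝓕.avg u K) x ∂ω :=
        lintegral_mono fun x => hlam.sq_sum_indicator_le _ x
    _ = 2 * ∑ J ∈ R', 𝓕.avg u J * ∑ K ∈ R' with K ⊆ J, 𝓕.avg u K * ω K := by
        simp_rw [← Finset.mul_sum]
        have hmJ : ∀ J, ∀ K ∈ R'.filter (· ⊆ J), MeasurableSet K :=
          fun J K hK => hm K (Finset.mem_filter.1 hK).1
        rw [lintegral_const_mul _ (Finset.measurable_sum _ fun J hJ =>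
            (measurable_sum_indicator (hmJ J) _).const_mul _),
          lintegral_finsetSum' _ fun J hJ =>
            ((measurable_sum_indicator (hmJ J) _).const_mul _).aemeasurable]
        congr 1
        refine Finset.sum_congr rfl fun J hJ => ?_
        rw [lintegral_const_mul _ (measurable_sum_indicator (hmJ J) _)]
        have := lintegral_sum_indicator_mul (hmJ J) (𝓕.avg u) (G := fun _ => 1)
          measurable_const ω
        simp only [mul_one, lintegral_const, Measure.restrict_apply, MeasurableSet.univ,
          Set.univ_inter, one_mul] at this
        rw [this]
    -- Since `ω K = v_K μ K`, the inner terms are `u_K v_K μ K`.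
    _ ≤ 2 * ∑ J ∈ R', 𝓕.avg u J * ∑ K ∈ R with K ⊆ J, c * μ K := by
        gcongr with J hJ
        refine le_trans (Finset.sum_le_sum (g := fun K => c * μ K) fun K hK => ?_)
          (Finset.sum_le_sum_of_subset (Finset.filter_subset_filter _ hR'R))
        have hKR' := (Finset.mem_filter.1 hK).1
        rw [hωJ K hKR', ← mul_assoc]
        gcongr
        exact hc K (hR'R hKR')
    _ ≤ 2 * ∑ J ∈ R', 𝓕.avg u J * (c * (2 * μ J)) := by
        simp_rw [← Finset.mul_sum]
        gcongr with J hJ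
        exact hR.sum_measure_le J
    _ = 4 * c * ∑ J ∈ R', ∫⁻ x in J, (u x : ℝ≥0∞) ∂μ := by
        rw [Finset.mul_sum, Finset.mul_sum]
        refine Finset.sum_congr rfl fun J hJ => ?_
        rw [← avg_mul_measure u (hlat J (hR'R hJ))]
        ring
    _ ≤ 4 * c * (2 * (D * 𝓕.avg u I * μ I)) := by
        gcongr
        refine (hR.sum_setLIntegral_le u (hlat I hI)).trans ?_
        gcongr
        exact hD I hI
    _ = _ := by
        rw [mul_assoc D, avg_mul_measure u (hlat I hI),
          withDensity_apply _ (measurableSet_of_mem_lattice (hlat I hI))]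
        ring

end AtomicFiltration

end EntropyBump

namespace EntropyBump

/-! ### The penalty function -/

/-- The integral test followed by Cauchy condensation, both for the decreasing function `1 / (t * α
t)`. -/
lemma summable_one_div_comp_two_pow {α : ℝ → ℝ} (hα_pos : ∀ t, 1 ≤ t → 0 < α t)
    (hα_mono : MonotoneOn (fun t => t * α t) (Ici 1))
    (hα_int : IntegrableOn (fun t => 1 / (t * α t)) (Ioi 1)) :
    Summable fun n : ℕ => 1 / α (2 ^ n) := by
  have hpos : ∀ t, 1 ≤ t → 0 < t * α t := fun t ht => mul_pos (by linarith) (hα_pos t ht)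
  have hanti : AntitoneOn (fun t => 1 / (t * α t)) (Ici 1) := fun s hs t ht hst =>
    one_div_le_one_div_of_le (hpos s hs) (hα_mono hs ht hst)
  have hs : Summable fun n : ℕ => 1 / ((n : ℝ) * α n) :=
    AntitoneOn.summable_of_integrableOn_Ioi (N := 1) (f := fun t => 1 / (t * α t))
      (by simpa using hanti) (by simpa using hα_int) fun t ht => by
        have : 1 < t := by simpa using ht
        exact (one_div_pos.2 (hpos t this.le)).le
  rw [← summable_condensed_iff_of_nonneg] at hs
  · refine hs.congr fun n => ?_
    push_cast
    field_simp
  · intro n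
    rcases Nat.eq_zero_or_pos n with rfl | hn
    · simp
    · exact (one_div_pos.2 (hpos n (by exact_mod_cast hn))).le
  · intro m n hm hmn
    have hm' : (1 : ℝ) ≤ m := by exact_mod_cast hm
    have hmn' : (m : ℝ) ≤ n := by exact_mod_cast hmn
    exact hanti hm' (hm'.trans hmn') hmn'

/-- Applied with `s = 2 ^ n`, `t = u*_I / u_I`, `x = u_I`, `y = v_I`. Only `t * α t` is monotone,
not `α`, so passing from `t` to `s` costs the factor `t / s ≤ 2`. -/
lemma mul_le_of_penalty {α : ℝ → ℝ} (hα_pos : ∀ t, 1 ≤ t → 0 < α t)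
    (hα_mono : MonotoneOn (fun t => t * α t) (Ici 1)) {A s t x y : ℝ} (hs : 1 ≤ s) (hst : s ≤ t)
    (hts : t ≤ 2 * s) (hx : 0 ≤ x) (hy : 0 ≤ y) (hA : 0 ≤ A)
    (h : α t ^ 2 * (t * x) * y ≤ A) : x * y ≤ 2 * A / (s * α s ^ 2) := by
  have hαs := hα_pos s hs
  have hs0 : 0 < s := by linarith
  have hmono : s * α s ≤ t * α t := hα_mono hs (hs.trans hst) hst
  rw [le_div_iff₀ (by positivity)]
  have h1 : (s * α s) ^ 2 ≤ (t * α t) ^ 2 := pow_le_pow_left₀ (by positivity) hmono 2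
  have h2 : x * y * (s * α s) ^ 2 ≤ s * (2 * A) :=
    calc x * y * (s * α s) ^ 2 ≤ x * y * (t * α t) ^ 2 :=
          mul_le_mul_of_nonneg_left h1 (mul_nonneg hx hy)
      _ = t * (α t ^ 2 * (t * x) * y) := by ring
      _ ≤ t * A := mul_le_mul_of_nonneg_left h (by linarith)
      _ ≤ 2 * s * A := mul_le_mul_of_nonneg_right hts hA
      _ = s * (2 * A) := by ring
  refine le_of_mul_le_mul_left ?_ hs0
  calc s * (x * y * (s * α s ^ 2)) = x * y * (s * α s) ^ 2 := by ring
    _ ≤ _ := h2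

variable {X : Type*} [m0 : MeasurableSpace X]

namespace AtomicFiltration

variable {μ : Measure X} {𝓕 : AtomicFiltration μ}

lemma avg_ne_top {u : X → ℝ≥0} {I : Set X} (hI : I ∈ 𝓕.lattice)
    (hu : ∫⁻ x in I, (u x : ℝ≥0∞) ∂μ < ∞) : 𝓕.avg u I ≠ ∞ := by
  rw [avg, setLAverage_eq]
  exact ENNReal.div_ne_top hu.ne (measure_ne_zero_of_mem_lattice hI)

/-- A set at which the bump condition holds belongs to some class `n` on which the entropy ratio is
about `2 ^ n`. -/
lemma exists_entropy_class {α : ℝ → ℝ} (hα_pos : ∀ t, 1 ≤ t → 0 < α t)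
    (hα_mono : MonotoneOn (fun t => t * α t) (Ici 1)) {u v : X → ℝ≥0} {I : Set X}
    (hI : I ∈ 𝓕.lattice) (hu : ∫⁻ x in I, (u x : ℝ≥0∞) ∂μ < ∞)
    (hv : ∫⁻ x in I, (v x : ℝ≥0∞) ∂μ < ∞) (hu0 : 𝓕.avg u I ≠ 0)
    (hT : 𝓕.entropyAvg u I ≠ ∞) {A : ℝ} (hA : 0 ≤ A)
    (h : α ((𝓕.entropyAvg u I).toReal / (𝓕.avg u I).toReal) ^ 2 *
        (𝓕.entropyAvg u I).toReal * (𝓕.avg v I).toReal ≤ A) :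
    ∃ n : ℕ, 𝓕.entropyAvg u I ≤ 2 ^ (n + 1) * 𝓕.avg u I ∧
      𝓕.avg u I * 𝓕.avg v I ≤ ENNReal.ofReal (2 * A / (2 ^ n * α (2 ^ n) ^ 2)) := by
  have huT := avg_ne_top hI hu
  have hvT := avg_ne_top hI hv
  set x := (𝓕.avg u I).toReal with hx
  set y := (𝓕.avg v I).toReal with hy
  set z := (𝓕.entropyAvg u I).toReal with hz
  have hx0 : 0 < x := ENNReal.toReal_pos hu0 huT
  have hxz : x ≤ z := ENNReal.toReal_mono hT (avg_le_entropyAvg u hI)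
  have h1 : 1 ≤ z / x := (one_le_div hx0).2 hxz
  obtain ⟨n, hn, hn'⟩ := exists_nat_pow_near h1 (one_lt_two)
  have hzx : z / x * x = z := div_mul_cancel₀ _ hx0.ne'
  refine ⟨n, ?_, ?_⟩
  · rw [← ENNReal.toReal_le_toReal hT (ENNReal.mul_ne_top (by finiteness) huT),
      ENNReal.toReal_mul, ← hx, ← hz, ← hzx]
    simp only [ENNReal.toReal_pow, ENNReal.toReal_ofNat]
    gcongr
  · refine (ENNReal.le_ofReal_iff_toReal_le (ENNReal.mul_ne_top huT hvT) (by positivity)).2 ?_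
    rw [ENNReal.toReal_mul, ← hx, ← hy]
    refine mul_le_of_penalty hα_pos hα_mono (one_le_pow₀ one_le_two) hn ?_ hx0.le
      ENNReal.toReal_nonneg hA (by rwa [hzx])
    rw [pow_succ] at hn'
    linarith

open Classical in
/-- A one-sided bump condition controls the part of the bilinear form where the averages of `F`
dominate. -/
theorem OneSidedBump.exists_sum_average_mul_le {α : ℝ → ℝ} (hα_pos : ∀ t, 1 ≤ t → 0 < α t)
    (hα_mono : MonotoneOn (fun t => t * α t) (Ici 1))
    (hα_int : IntegrableOn (fun t => 1 / (t * α t)) (Ioi 1)) {u v : X → ℝ≥0}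
    (hu_int : ∀ I ∈ 𝓕.lattice, ∫⁻ x in I, (u x : ℝ≥0∞) ∂μ < ∞)
    (hv_int : ∀ I ∈ 𝓕.lattice, ∫⁻ x in I, (v x : ℝ≥0∞) ∂μ < ∞)
    (huv : 𝓕.OneSidedBump α u v) {σ ω : Measure X}
    (hσ : σ = μ.withDensity fun x => (u x : ℝ≥0∞))
    (hω : ω = μ.withDensity fun x => (v x : ℝ≥0∞)) :
    ∃ C : ℝ≥0, ∀ R : Finset (Set X), 𝓕.IsSparse (R : Set (Set X)) →
      (∀ J ∈ R, σ J ≠ 0) → (∀ J ∈ R, ω J ≠ 0) →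
      ∀ F G : X → ℝ≥0∞, Measurable F → Measurable G → ∀ a b : Set X → ℝ≥0∞,
      (∀ J ∈ R, a J * σ J = ∫⁻ x in J, F x ∂σ) → (∀ J ∈ R, a J ≠ 0) → (∀ J ∈ R, a J ≠ ∞) →
      (∀ J ∈ R, b J * ω J = ∫⁻ x in J, G x ∂ω) →
      (∀ J ∈ R, b J ^ 2 * ω J ≤ a J ^ 2 * σ J) →
      ∑ J ∈ R, a J * (𝓕.avg u J * ∫⁻ x in J, G x ∂ω) ≤
        C * (∫⁻ x, F x ^ 2 ∂σ + ∫⁻ x, G x ^ 2 ∂ω) := by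
  obtain ⟨A₀, hA₀⟩ := huv
  -- With `A ≥ 1` every `κ n` is positive, and `(32 * A) ^ 2` dominates the testing factor `32 * A`.
  set A := max A₀ 1 with hAdef
  have hA1 : 1 ≤ A := le_max_right _ _
  have hsum := summable_one_div_comp_two_pow hα_pos hα_mono hα_int
  set κ : ℕ → ℝ≥0 := fun n => (32 * A * (1 / α (2 ^ n))).toNNReal with hκ
  have hα2 : ∀ n : ℕ, 0 < α (2 ^ n) := fun n => hα_pos _ (one_le_pow₀ one_le_two)
  have hκ0 : ∀ n, κ n ≠ 0 := fun n => by
    have := hα2 n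
    exact (Real.toNNReal_pos.2 (by positivity)).ne'
  have hκsum : Summable κ := (hsum.mul_left (32 * A)).toNNReal
  have hκsq : ∀ n, 8 * ENNReal.ofReal (2 * A / (2 ^ n * α (2 ^ n) ^ 2)) * 2 ^ (n + 1) ≤
      (κ n : ℝ≥0∞) ^ 2 := fun n => by
    have := hα2 n
    have h8 : (8 : ℝ≥0∞) = ENNReal.ofReal 8 := by simp
    have h2 : (2 : ℝ≥0∞) ^ (n + 1) = ENNReal.ofReal (2 ^ (n + 1)) := by
      rw [ENNReal.ofReal_pow zero_le_two]
      simp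
    have hk : (κ n : ℝ≥0∞) ^ 2 = ENNReal.ofReal ((32 * A * (1 / α (2 ^ n))) ^ 2) := by
      rw [ENNReal.ofReal_pow (by positivity)]
      rfl
    rw [h8, h2, hk, ← ENNReal.ofReal_mul (by norm_num), ← ENNReal.ofReal_mul (by positivity)]
    refine ENNReal.ofReal_le_ofReal ?_
    have e1 : 8 * (2 * A / (2 ^ n * α (2 ^ n) ^ 2)) * 2 ^ (n + 1) =
        32 * A * (1 / α (2 ^ n)) ^ 2 := by
      field_simp
      ring
    have e2 : (32 * A * (1 / α (2 ^ n))) ^ 2 = (32 * A) * (32 * A * (1 / α (2 ^ n)) ^ 2) := by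
      ring
    rw [e1, e2]
    exact le_mul_of_one_le_left (by positivity) (by linarith)
  refine ⟨32 * ∑' n, κ n, fun R hR hσ0 hω0 F G hF hG a b ha ha0 haT hb hba => ?_⟩
  have hlat : ∀ J ∈ R, J ∈ 𝓕.lattice := fun J hJ => hR.subset_lattice hJ
  have hm : ∀ J ∈ R, MeasurableSet J := fun J hJ => measurableSet_of_mem_lattice (hlat J hJ)
  have hσT : ∀ J ∈ R, σ J ≠ ∞ := fun J hJ => by
    rw [hσ, withDensity_apply _ (hm J hJ)]
    exact (hu_int J (hlat J hJ)).ne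
  have hclass : ∀ J, ∃ n : ℕ, J ∈ R → 𝓕.entropyAvg u J ≤ 2 ^ (n + 1) * 𝓕.avg u J ∧
      𝓕.avg u J * 𝓕.avg v J ≤ ENNReal.ofReal (2 * A / (2 ^ n * α (2 ^ n) ^ 2)) := by
    intro J
    by_cases hJ : J ∈ R
    · have hJl := hlat J hJ
      have hu0 : 𝓕.avg u J ≠ 0 := fun h => hσ0 J hJ <| by
        rw [hσ, withDensity_apply _ (hm J hJ), ← avg_mul_measure u hJl, h, zero_mul]
      have hv0 : 𝓕.avg v J ≠ 0 := fun h => hω0 J hJ <| by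
        rw [hω, withDensity_apply _ (hm J hJ), ← avg_mul_measure v hJl, h, zero_mul]
      obtain ⟨hT, hle⟩ := hA₀ J hJl hu0 hv0
      obtain ⟨n, hn⟩ := exists_entropy_class hα_pos hα_mono hJl (hu_int J hJl) (hv_int J hJl)
        hu0 hT (zero_le_one.trans hA1) (hle.trans (le_max_left _ _))
      exact ⟨n, fun _ => hn⟩
    · exact ⟨0, fun h => absurd h hJ⟩
  choose cls hcls using hclass
  set N := ∫⁻ x, F x ^ 2 ∂σ + ∫⁻ x, G x ^ 2 ∂ω with hN
  have hfiber : ∀ n, ∑ J ∈ R with cls J = n, a J * (𝓕.avg u J * ∫⁻ x in J, G x ∂ω) ≤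
      32 * κ n * N := by
    intro n
    have hsub : ∀ J ∈ R.filter (cls · = n), J ∈ R := fun J hJ => (Finset.mem_filter.1 hJ).1
    have hRn : 𝓕.IsSparse (R.filter (cls · = n) : Finset (Set X)) := hR.mono hsub
    have hcn : ∀ J ∈ R.filter (cls · = n), 𝓕.entropyAvg u J ≤ 2 ^ (n + 1) * 𝓕.avg u J ∧
        𝓕.avg u J * 𝓕.avg v J ≤ ENNReal.ofReal (2 * A / (2 ^ n * α (2 ^ n) ^ 2)) := by
      intro J hJ
      obtain ⟨hJR, rfl⟩ := Finset.mem_filter.1 hJ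
      exact hcls J hJR
    refine sum_average_mul_le_of_testing (fun J hJ => hm J (hsub J hJ))
      (𝓕.isLaminar_lattice.mono hRn.subset_lattice) (fun J hJ => hσ0 J (hsub J hJ))
      (fun J hJ => hσT J (hsub J hJ)) hF hG (fun J hJ => ha J (hsub J hJ))
      (fun J hJ => ha0 J (hsub J hJ)) (fun J hJ => haT J (hsub J hJ))
      (fun J hJ => hb J (hsub J hJ)) (fun J hJ => hba J (hsub J hJ)) (𝓕.avg u) (hκ0 n)
      fun I hI => ?_
    have := hRn.testing u v (fun J hJ => (hcn J hJ).2) (fun J hJ => (hcn J hJ).1) hI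
    rw [← hσ, ← hω] at this
    exact this.trans (mul_le_mul_left (hκsq n) _)
  calc ∑ J ∈ R, a J * (𝓕.avg u J * ∫⁻ x in J, G x ∂ω)
      = ∑ n ∈ R.image cls, ∑ J ∈ R with cls J = n, a J * (𝓕.avg u J * ∫⁻ x in J, G x ∂ω) :=
        (Finset.sum_fiberwise_of_maps_to (fun J hJ => Finset.mem_image_of_mem cls hJ) _).symm
    _ ≤ ∑ n ∈ R.image cls, 32 * κ n * N := Finset.sum_le_sum fun n _ => hfiber n
    _ = 32 * ((∑ n ∈ R.image cls, κ n : ℝ≥0) : ℝ≥0∞) * N := by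
        rw [← Finset.sum_mul, ← Finset.mul_sum]
        push_cast
        rfl
    _ ≤ 32 * ((∑' n, κ n : ℝ≥0) : ℝ≥0∞) * N := by
        gcongr
        exact hκsum.sum_le_tsum _ fun _ _ => zero_le
    _ = _ := by
        push_cast
        rfl

end AtomicFiltration

end EntropyBump

namespace EntropyBump

variable {X : Type*} [m0 : MeasurableSpace X]

namespace AtomicFiltration

variable {μ : Measure X} {𝓕 : AtomicFiltration μ}

/-! ### The sparse operator -/

open Classical in
/-- The bilinear form of the sparse operators under the separated bump conditions. -/
theorem exists_sum_setLIntegral_mul_le {α : ℝ → ℝ} (hα_pos : ∀ t, 1 ≤ t → 0 < α t)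
    (hα_mono : MonotoneOn (fun t => t * α t) (Ici 1))
    (hα_int : IntegrableOn (fun t => 1 / (t * α t)) (Ioi 1)) {u v : X → ℝ≥0}
    (hu_int : ∀ I ∈ 𝓕.lattice, ∫⁻ x in I, (u x : ℝ≥0∞) ∂μ < ∞)
    (hv_int : ∀ I ∈ 𝓕.lattice, ∫⁻ x in I, (v x : ℝ≥0∞) ∂μ < ∞)
    (huv : 𝓕.OneSidedBump α u v) (hvu : 𝓕.OneSidedBump α v u) {σ ω : Measure X}
    (hσ : σ = μ.withDensity fun x => (u x : ℝ≥0∞))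
    (hω : ω = μ.withDensity fun x => (v x : ℝ≥0∞)) :
    ∃ C : ℝ≥0, ∀ R : Finset (Set X), 𝓕.IsSparse (R : Set (Set X)) →
      ∀ F G : X → ℝ≥0∞, Measurable F → Measurable G →
      (∀ J ∈ R, ∫⁻ x in J, F x ∂σ ≠ ∞) → (∀ J ∈ R, ∫⁻ x in J, G x ∂ω ≠ ∞) →
      ∑ J ∈ R, (∫⁻ x in J, F x ∂σ) / μ J * ∫⁻ x in J, G x ∂ω ≤
        C * (∫⁻ x, F x ^ 2 ∂σ + ∫⁻ x, G x ^ 2 ∂ω) := by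
  obtain ⟨C₁, hC₁⟩ :=
    huv.exists_sum_average_mul_le hα_pos hα_mono hα_int hu_int hv_int hσ hω
  obtain ⟨C₂, hC₂⟩ :=
    hvu.exists_sum_average_mul_le hα_pos hα_mono hα_int hv_int hu_int hω hσ
  refine ⟨C₁ + C₂, fun R hR F G hF hG hFT hGT => ?_⟩
  have hlat : ∀ J ∈ R, J ∈ 𝓕.lattice := fun J hJ => hR.subset_lattice hJ
  have hm : ∀ J ∈ R, MeasurableSet J := fun J hJ => measurableSet_of_mem_lattice (hlat J hJ)
  have hσJ : ∀ J ∈ R, σ J = ∫⁻ x in J, (u x : ℝ≥0∞) ∂μ := fun J hJ => by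
    rw [hσ, withDensity_apply _ (hm J hJ)]
  have hωJ : ∀ J ∈ R, ω J = ∫⁻ x in J, (v x : ℝ≥0∞) ∂μ := fun J hJ => by
    rw [hω, withDensity_apply _ (hm J hJ)]
  have hσT : ∀ J ∈ R, σ J ≠ ∞ := fun J hJ => hσJ J hJ ▸ (hu_int J (hlat J hJ)).ne
  have hωT : ∀ J ∈ R, ω J ≠ ∞ := fun J hJ => hωJ J hJ ▸ (hv_int J (hlat J hJ)).ne
  set f : Set X → ℝ≥0∞ := fun J => ∫⁻ x in J, F x ∂σ with hf
  set g : Set X → ℝ≥0∞ := fun J => ∫⁻ x in J, G x ∂ω with hg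
  set a : Set X → ℝ≥0∞ := fun J => f J / σ J with ha
  set b : Set X → ℝ≥0∞ := fun J => g J / ω J with hb
  -- Nonvanishing measures make `a`, `b` genuine averages; `f J ≠ 0` gives `a J ≠ 0`, so that its
  -- dyadic level exists. The overlap with `R₂` is harmless.
  set R₁ := R.filter fun J =>
    (σ J ≠ 0 ∧ ω J ≠ 0) ∧ f J ≠ 0 ∧ b J ^ 2 * ω J ≤ a J ^ 2 * σ J with hR₁
  set R₂ := R.filter fun J =>
    (σ J ≠ 0 ∧ ω J ≠ 0) ∧ g J ≠ 0 ∧ a J ^ 2 * σ J ≤ b J ^ 2 * ω J with hR₂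
  have hR₁R : ∀ J ∈ R₁, J ∈ R := fun J hJ => (Finset.mem_filter.1 hJ).1
  have hR₂R : ∀ J ∈ R₂, J ∈ R := fun J hJ => (Finset.mem_filter.1 hJ).1
  have haσ : ∀ J ∈ R, σ J ≠ 0 → a J * σ J = f J := fun J hJ h0 =>
    ENNReal.div_mul_cancel h0 (hσT J hJ)
  have hbω : ∀ J ∈ R, ω J ≠ 0 → b J * ω J = g J := fun J hJ h0 =>
    ENNReal.div_mul_cancel h0 (hωT J hJ)
  have h₁ := hC₁ R₁ (hR.mono hR₁R) (fun J hJ => (Finset.mem_filter.1 hJ).2.1.1)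
    (fun J hJ => (Finset.mem_filter.1 hJ).2.1.2) F G hF hG a b
    (fun J hJ => haσ J (hR₁R J hJ) (Finset.mem_filter.1 hJ).2.1.1)
    (fun J hJ => (ENNReal.div_pos (Finset.mem_filter.1 hJ).2.2.1 (hσT J (hR₁R J hJ))).ne')
    (fun J hJ => ENNReal.div_ne_top (hFT J (hR₁R J hJ)) (Finset.mem_filter.1 hJ).2.1.1)
    (fun J hJ => hbω J (hR₁R J hJ) (Finset.mem_filter.1 hJ).2.1.2)
    (fun J hJ => (Finset.mem_filter.1 hJ).2.2.2)
  have h₂ := hC₂ R₂ (hR.mono hR₂R) (fun J hJ => (Finset.mem_filter.1 hJ).2.1.2)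
    (fun J hJ => (Finset.mem_filter.1 hJ).2.1.1) G F hG hF b a
    (fun J hJ => hbω J (hR₂R J hJ) (Finset.mem_filter.1 hJ).2.1.2)
    (fun J hJ => (ENNReal.div_pos (Finset.mem_filter.1 hJ).2.2.1 (hωT J (hR₂R J hJ))).ne')
    (fun J hJ => ENNReal.div_ne_top (hGT J (hR₂R J hJ)) (Finset.mem_filter.1 hJ).2.1.2)
    (fun J hJ => haσ J (hR₂R J hJ) (Finset.mem_filter.1 hJ).2.1.1)
    (fun J hJ => (Finset.mem_filter.1 hJ).2.2.2)
  have e₁ : ∀ J ∈ R₁, f J / μ J * g J = a J * (𝓕.avg u J * g J) := fun J hJ => by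
    have hJR := hR₁R J hJ
    rw [avg, setLAverage_eq, ← hσJ J hJR, ← haσ J hJR (Finset.mem_filter.1 hJ).2.1.1]
    simp only [div_eq_mul_inv]
    ring
  have e₂ : ∀ J ∈ R₂, f J / μ J * g J = b J * (𝓕.avg v J * f J) := fun J hJ => by
    have hJR := hR₂R J hJ
    rw [avg, setLAverage_eq, ← hωJ J hJR, ← hbω J hJR (Finset.mem_filter.1 hJ).2.1.2]
    simp only [div_eq_mul_inv]
    ring
  have hcover : ∀ J ∈ R, f J / μ J * g J ≠ 0 → J ∈ R₁ ∪ R₂ := by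
    intro J hJ h0
    have hf0 : f J ≠ 0 := fun h => h0 (by simp [h])
    have hg0 : g J ≠ 0 := fun h => h0 (by simp [h])
    have hσ0 : σ J ≠ 0 := fun h => hf0 (setLIntegral_measure_zero _ _ h)
    have hω0 : ω J ≠ 0 := fun h => hg0 (setLIntegral_measure_zero _ _ h)
    rcases le_total (b J ^ 2 * ω J) (a J ^ 2 * σ J) with h | h
    · exact Finset.mem_union_left _ (Finset.mem_filter.2 ⟨hJ, ⟨hσ0, hω0⟩, hf0, h⟩)
    · exact Finset.mem_union_right _ (Finset.mem_filter.2 ⟨hJ, ⟨hσ0, hω0⟩, hg0, h⟩)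
  calc ∑ J ∈ R, f J / μ J * g J ≤ ∑ J ∈ R₁ ∪ R₂, f J / μ J * g J :=
        Finset.sum_le_sum_of_ne_zero hcover
    _ ≤ ∑ J ∈ R₁, f J / μ J * g J + ∑ J ∈ R₂, f J / μ J * g J := by
        rw [← Finset.sum_union_inter]
        exact le_self_add
    _ = ∑ J ∈ R₁, a J * (𝓕.avg u J * g J) + ∑ J ∈ R₂, b J * (𝓕.avg v J * f J) := by
        rw [Finset.sum_congr rfl e₁, Finset.sum_congr rfl e₂]
    _ ≤ _ := by
        refine (add_le_add h₁ h₂).trans_eq ?_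
        push_cast
        ring

/-- The weighted bound for finite sparse families. -/
theorem exists_lintegral_sq_sum_le {α : ℝ → ℝ} (hα_pos : ∀ t, 1 ≤ t → 0 < α t)
    (hα_mono : MonotoneOn (fun t => t * α t) (Ici 1))
    (hα_int : IntegrableOn (fun t => 1 / (t * α t)) (Ioi 1)) {u v : X → ℝ≥0}
    (hu_int : ∀ I ∈ 𝓕.lattice, ∫⁻ x in I, (u x : ℝ≥0∞) ∂μ < ∞)
    (hv_int : ∀ I ∈ 𝓕.lattice, ∫⁻ x in I, (v x : ℝ≥0∞) ∂μ < ∞)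
    (huv : 𝓕.OneSidedBump α u v) (hvu : 𝓕.OneSidedBump α v u) {σ ω : Measure X}
    (hσ : σ = μ.withDensity fun x => (u x : ℝ≥0∞))
    (hω : ω = μ.withDensity fun x => (v x : ℝ≥0∞)) :
    ∃ C : ℝ≥0, ∀ R : Finset (Set X), 𝓕.IsSparse (R : Set (Set X)) →
      ∀ F : X → ℝ≥0∞, Measurable F → (∀ J ∈ R, ∫⁻ x in J, F x ∂σ ≠ ∞) →
      ∫⁻ x, (∑ J ∈ R, J.indicator (fun _ => (∫⁻ y in J, F y ∂σ) / μ J) x) ^ 2 ∂ω ≤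
        C * ∫⁻ x, F x ^ 2 ∂σ := by
  obtain ⟨C₀, hC₀⟩ :=
    exists_sum_setLIntegral_mul_le hα_pos hα_mono hα_int hu_int hv_int huv hvu hσ hω
  set C := C₀ + 1 with hC
  have hC0 : C ≠ 0 := by positivity
  refine ⟨4 * C ^ 2, fun R hR F hF hFT => ?_⟩
  have hlat : ∀ J ∈ R, J ∈ 𝓕.lattice := fun J hJ => hR.subset_lattice hJ
  have hm : ∀ J ∈ R, MeasurableSet J := fun J hJ => measurableSet_of_mem_lattice (hlat J hJ)
  have hωT : ∀ J ∈ R, ω J ≠ ∞ := fun J hJ => by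
    rw [hω, withDensity_apply _ (hm J hJ)]
    exact (hv_int J (hlat J hJ)).ne
  set c : Set X → ℝ≥0∞ := fun J => (∫⁻ y in J, F y ∂σ) / μ J with hc
  have hcT : ∀ J ∈ R, c J ≠ ∞ := fun J hJ =>
    ENNReal.div_ne_top (hFT J hJ) (measure_ne_zero_of_mem_lattice (hlat J hJ))
  set h : X → ℝ≥0∞ := fun x => ∑ J ∈ R, J.indicator (fun _ => c J) x with hh
  have hhm : Measurable h := measurable_sum_indicator hm c
  have hH : ∀ x, h x ≤ ∑ J ∈ R, c J := fun x =>
    Finset.sum_le_sum fun J _ => Set.indicator_le_self _ _ x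
  have hHT : ∑ J ∈ R, c J ≠ ∞ := ENNReal.sum_ne_top.2 hcT
  have hhT : ∀ J ∈ R, ∫⁻ x in J, h x ∂ω ≠ ∞ := fun J hJ => by
    refine ne_top_of_le_ne_top (ENNReal.mul_ne_top hHT (hωT J hJ)) ?_
    rw [← setLIntegral_const]
    exact lintegral_mono hH
  have hdual : ∫⁻ x, h x ^ 2 ∂ω = ∑ J ∈ R, c J * ∫⁻ x in J, h x ∂ω := by
    rw [← lintegral_sum_indicator_mul hm c hhm]
    exact lintegral_congr fun x => sq _
  -- A finite sum of bounded functions on sets of finite `ω`-measure; needed for the absorption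
  -- below.
  have hYT : ∫⁻ x, h x ^ 2 ∂ω ≠ ∞ := by
    rw [hdual]
    exact ENNReal.sum_ne_top.2 fun J hJ => ENNReal.mul_ne_top (hcT J hJ) (hhT J hJ)
  set Y := ∫⁻ x, h x ^ 2 ∂ω with hY
  -- The form is tested on `G = s * h`. This choice of `s` turns the resulting inequality into `Y ≤
  -- 2 C² ∫ F² dσ + Y / 2`.
  set s : ℝ≥0 := (2 * C)⁻¹ with hs
  have key : s * Y ≤ C * (∫⁻ x, F x ^ 2 ∂σ + s ^ 2 * Y) := by
    have h1 := hC₀ R hR F (fun x => s * h x) hF (hhm.const_mul _) hFT fun J hJ => by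
      rw [lintegral_const_mul _ hhm]
      exact ENNReal.mul_ne_top ENNReal.coe_ne_top (hhT J hJ)
    simp_rw [mul_pow] at h1
    rw [lintegral_const_mul _ (hhm.pow_const 2)] at h1
    refine le_trans (le_of_eq ?_) (h1.trans (mul_le_mul_left ?_ _))
    · rw [hdual, Finset.mul_sum]
      refine Finset.sum_congr rfl fun J _ => ?_
      rw [lintegral_const_mul _ hhm]
      ring
    · exact_mod_cast le_self_add
  have e1 : ((2 * C * s : ℝ≥0) : ℝ≥0∞) = 1 := by
    rw [hs, mul_inv_cancel₀ (by positivity), ENNReal.coe_one]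
  have e2 : ((2 * C * C * s ^ 2 : ℝ≥0) : ℝ≥0∞) = 2⁻¹ := by
    have : 2 * C * C * s ^ 2 = 2⁻¹ := by
      rw [hs]
      field_simp
    rw [this, ENNReal.coe_inv two_ne_zero, ENNReal.coe_ofNat]
  have hle : Y ≤ 2 * C ^ 2 * ∫⁻ x, F x ^ 2 ∂σ + Y / 2 := by
    calc Y = ((2 * C * s : ℝ≥0) : ℝ≥0∞) * Y := by rw [e1, one_mul]
      _ = 2 * C * (s * Y) := by
          push_cast
          ring
      _ ≤ 2 * C * (C * (∫⁻ x, F x ^ 2 ∂σ + s ^ 2 * Y)) := by gcongr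
      _ = 2 * C ^ 2 * ∫⁻ x, F x ^ 2 ∂σ + ((2 * C * C * s ^ 2 : ℝ≥0) : ℝ≥0∞) * Y := by
          push_cast
          ring
      _ = _ := by rw [e2, div_eq_mul_inv, mul_comm Y]
  refine (le_two_mul_of_le_add_half hYT hle).trans_eq ?_
  push_cast
  ring

/-- The weighted bound for sparse families and nonnegative functions. -/
theorem exists_lintegral_sq_tsum_le {α : ℝ → ℝ} (hα_pos : ∀ t, 1 ≤ t → 0 < α t)
    (hα_mono : MonotoneOn (fun t => t * α t) (Ici 1))
    (hα_int : IntegrableOn (fun t => 1 / (t * α t)) (Ioi 1)) {u v : X → ℝ≥0}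
    (hu_int : ∀ I ∈ 𝓕.lattice, ∫⁻ x in I, (u x : ℝ≥0∞) ∂μ < ∞)
    (hv_int : ∀ I ∈ 𝓕.lattice, ∫⁻ x in I, (v x : ℝ≥0∞) ∂μ < ∞)
    (huv : 𝓕.OneSidedBump α u v) (hvu : 𝓕.OneSidedBump α v u) {σ ω : Measure X}
    (hσ : σ = μ.withDensity fun x => (u x : ℝ≥0∞))
    (hω : ω = μ.withDensity fun x => (v x : ℝ≥0∞)) :
    ∃ C : ℝ≥0, ∀ Q : Set (Set X), 𝓕.IsSparse Q →
      ∀ F : X → ℝ≥0∞, Measurable F → ∫⁻ x, F x ^ 2 ∂σ ≠ ∞ →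
      ∫⁻ x, (∑' J : Q, (J : Set X).indicator (fun _ => (∫⁻ y in J, F y ∂σ) / μ J) x) ^ 2 ∂ω ≤
        C * ∫⁻ x, F x ^ 2 ∂σ := by
  classical
  obtain ⟨C, hC⟩ :=
    exists_lintegral_sq_sum_le hα_pos hα_mono hα_int hu_int hv_int huv hvu hσ hω
  refine ⟨C, fun Q hQ F hF hFT => ?_⟩
  have : Countable Q := (𝓕.countable_lattice.mono hQ.subset_lattice).to_subtype
  have hm : ∀ J : Q, MeasurableSet (J : Set X) :=
    fun J => measurableSet_of_mem_lattice (hQ.subset_lattice J.2)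
  have hfT : ∀ J ∈ Q, ∫⁻ x in J, F x ∂σ ≠ ∞ := fun J hJ => by
    have hσJ : σ J ≠ ∞ := by
      rw [hσ, withDensity_apply _ (hm ⟨J, hJ⟩)]
      exact (hu_int J (hQ.subset_lattice hJ)).ne
    refine ne_top_of_le_ne_top (ENNReal.add_ne_top.2 ⟨hFT, hσJ⟩) ?_
    calc ∫⁻ x in J, F x ∂σ ≤ ∫⁻ x in J, (F x ^ 2 + 1) ∂σ := by
          refine lintegral_mono fun x => ?_
          have h := two_mul_mul_le_add_sq_inv (F x) 1 one_ne_zero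
          simp only [mul_one, ENNReal.coe_one, inv_one, one_mul, one_pow] at h
          exact le_trans (le_mul_of_one_le_left zero_le (by norm_num)) h
      _ = ∫⁻ x in J, F x ^ 2 ∂σ + σ J := by
          rw [lintegral_add_right _ measurable_const, setLIntegral_one]
      _ ≤ _ := add_le_add_left (setLIntegral_le_lintegral _ _) _
  set t : Q → X → ℝ≥0∞ := fun J x =>
    (J : Set X).indicator (fun _ => (∫⁻ y in J, F y ∂σ) / μ J) x with ht
  have htm : ∀ J, Measurable (t J) := fun J => measurable_const.indicator (hm J)
  -- Finite subfamilies of a sparse family are sparse with the same bound, so monotone convergence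
  -- passes to `Q`.
  have hsup : ∀ x, (∑' J, t J x) ^ 2 = ⨆ s : Finset Q, (∑ J ∈ s, t J x) ^ 2 := fun x => by
    rw [ENNReal.tsum_eq_iSup_sum, ENNReal.iSup_pow]
  refine (lintegral_congr hsup).trans_le ?_
  rw [lintegral_iSup_directed_of_measurable
    (fun s => (Finset.measurable_sum _ fun J _ => htm J).pow_const 2)
    (directed_of_isDirected_le fun s s' hss' x =>
      pow_le_pow_left' (Finset.sum_le_sum_of_subset hss') 2)]
  refine iSup_le fun s => ?_
  have hsQ : ∀ J ∈ s.map (Function.Embedding.subtype (· ∈ Q)), J ∈ Q := fun J hJ => by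
    obtain ⟨K, -, rfl⟩ := Finset.mem_map.1 hJ
    exact K.2
  have := hC (s.map (Function.Embedding.subtype _)) (hQ.mono hsQ) F hF
    fun J hJ => hfT J (hsQ J hJ)
  simpa only [Finset.sum_map, Function.Embedding.subtype_apply] using this

end AtomicFiltration

end EntropyBump

/-! ### Reduction of real or complex functions to nonnegative ones -/

theorem mainTheorem2 {X : Type*} [MeasurableSpace X] (μ : Measure X) [SigmaFinite μ]
    (𝓕 : EntropyBump.AtomicFiltration μ) {𝕜 : Type*} [RCLike 𝕜]
    -- the penalty function
    (α : ℝ → ℝ) (hα_pos : ∀ t, 1 ≤ t → 0 < α t)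
    (hα_mono : MonotoneOn (fun t => t * α t) (Ici 1))
    (hα_int : IntegrableOn (fun t => 1 / (t * α t)) (Ioi 1))
    -- the weights
    (u v : X → ℝ≥0) (hu : Measurable u) (hv : Measurable v)
    (hu_int : ∀ I ∈ 𝓕.lattice, ∫⁻ x in I, (u x : ℝ≥0∞) ∂μ < ∞)
    (hv_int : ∀ I ∈ 𝓕.lattice, ∫⁻ x in I, (v x : ℝ≥0∞) ∂μ < ∞)
    -- the separated bump conditions
    (huv : 𝓕.OneSidedBump α u v) (hvu : 𝓕.OneSidedBump α v u) :
    ∃ C : ℝ≥0, ∀ Q : Set (Set X), 𝓕.IsSparse Q →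
      ∀ f : X → 𝕜, MemLp f 2 (μ.withDensity fun x => (u x : ℝ≥0∞)) →
        -- the series that defines `T(fu)` converges absolutely `v dx`-almost everywhere
        (∀ᵐ x ∂(μ.withDensity fun x => (v x : ℝ≥0∞)),
          Summable fun I : Q =>
            EntropyBump.sparseTerm μ (fun y => f y * ((u y : ℝ) : 𝕜)) (I : Set X) x) ∧
        ∫⁻ x, ‖EntropyBump.sparseOp μ Q (fun y => f y * ((u y : ℝ) : 𝕜)) x‖ₑ ^ 2 * v x ∂μ
          ≤ C * ∫⁻ x, ‖f x‖ₑ ^ 2 * u x ∂μ := by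
  have hu' : Measurable fun x => (u x : ℝ≥0∞) := hu.coe_nnreal_ennreal
  have hv' : Measurable fun x => (v x : ℝ≥0∞) := hv.coe_nnreal_ennreal
  obtain ⟨C, hC⟩ := EntropyBump.AtomicFiltration.exists_lintegral_sq_tsum_le hα_pos hα_mono hα_int
    hu_int hv_int huv hvu rfl rfl
  refine ⟨C, fun Q hQ f hf => ?_⟩
  set σ := μ.withDensity fun x => (u x : ℝ≥0∞) with hσ
  set ω := μ.withDensity fun x => (v x : ℝ≥0∞) with hω
  have : Countable Q := (𝓕.countable_lattice.mono hQ.subset_lattice).to_subtype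
  set g := hf.1.mk f with hg
  have hgm : Measurable fun x => ‖g x‖ₑ := hf.1.stronglyMeasurable_mk.enorm
  -- The measurable representative agrees with `f` only where `u ≠ 0`, which suffices because `f`
  -- enters through `f * u` and `|f|² u`.
  have hfg : ∀ᵐ x ∂μ, (u x : ℝ≥0∞) ≠ 0 → f x = g x :=
    (ae_withDensity_iff hu').1 hf.1.ae_eq_mk
  have hN : ∫⁻ x, ‖g x‖ₑ ^ 2 ∂σ = ∫⁻ x, ‖f x‖ₑ ^ 2 * u x ∂μ := by
    rw [hσ, lintegral_withDensity_eq_lintegral_mul _ hu' (hgm.pow_const 2)]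
    refine lintegral_congr_ae (hfg.mono fun x hx => ?_)
    by_cases h0 : (u x : ℝ≥0∞) = 0
    · simp [h0]
    · simp [hx h0, mul_comm]
  have hNT : ∫⁻ x, ‖g x‖ₑ ^ 2 ∂σ ≠ ∞ := by
    have h1 := (memLp_congr_ae hf.1.ae_eq_mk).1 hf
    have h2 := lintegral_rpow_enorm_lt_top_of_eLpNorm_lt_top two_ne_zero ENNReal.ofNat_ne_top h1.2
    simpa using h2.ne
  set H : X → ℝ≥0∞ := fun x =>
    ∑' J : Q, (J : Set X).indicator (fun _ => (∫⁻ y in J, ‖g y‖ₑ ∂σ) / μ J) x with hH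
  have hHm : Measurable H := Measurable.tsum fun J => measurable_const.indicator
    (EntropyBump.AtomicFiltration.measurableSet_of_mem_lattice (hQ.subset_lattice J.2))
  have hHle : ∫⁻ x, H x ^ 2 ∂ω ≤ C * ∫⁻ x, ‖g x‖ₑ ^ 2 ∂σ := hC Q hQ _ hgm hNT
  have hterm : ∀ (J : Q) (x : X),
      ‖EntropyBump.sparseTerm μ (fun y => f y * ((u y : ℝ) : 𝕜)) (J : Set X) x‖ₑ ≤
        (J : Set X).indicator (fun _ => (∫⁻ y in J, ‖g y‖ₑ ∂σ) / μ J) x := by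
    intro J x
    have hJm : MeasurableSet (J : Set X) :=
      EntropyBump.AtomicFiltration.measurableSet_of_mem_lattice (hQ.subset_lattice J.2)
    by_cases hx : x ∈ (J : Set X)
    · rw [EntropyBump.sparseTerm, Set.indicator_of_mem hx, Set.indicator_of_mem hx]
      refine (enorm_integral_le_lintegral_enorm _).trans ?_
      change ⨍⁻ y in (J : Set X), ‖f y * ((u y : ℝ) : 𝕜)‖ₑ ∂μ ≤ _
      rw [setLAverage_eq, hσ, setLIntegral_withDensity_eq_setLIntegral_mul _ hu' hgm hJm]
      gcongr ?_ / _
      refine lintegral_mono_ae (ae_restrict_of_ae (hfg.mono fun y hy => ?_))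
      have hnorm : ‖((u y : ℝ) : 𝕜)‖ₑ = u y := by
        rw [← ofReal_norm, RCLike.norm_ofReal, abs_of_nonneg (NNReal.coe_nonneg _)]
        exact ENNReal.ofReal_coe_nnreal
      rw [enorm_mul, hnorm, Pi.mul_apply]
      by_cases h0 : (u y : ℝ≥0∞) = 0
      · simp [h0]
      · rw [hy h0, mul_comm]
    · simp [EntropyBump.sparseTerm, hx]
  -- Holds at every `x`: where the series is not summable, the operator takes the value 0.
  have hTle : ∀ x, ‖EntropyBump.sparseOp μ Q (fun y => f y * ((u y : ℝ) : 𝕜)) x‖ₑ ≤ H x :=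
    fun x => enorm_tsum_le_tsum_enorm.trans (ENNReal.tsum_le_tsum fun J => hterm J x)
  refine ⟨?_, ?_⟩
  · have hlt : ∀ᵐ x ∂ω, H x ^ 2 < ∞ := ae_lt_top (hHm.pow_const 2)
      (ne_top_of_le_ne_top (ENNReal.mul_ne_top ENNReal.coe_ne_top hNT) hHle)
    refine hlt.mono fun x hx => ?_
    have hxT : H x ≠ ∞ := fun h => by simp [h] at hx
    refine Summable.of_nnnorm (ENNReal.tsum_coe_ne_top_iff_summable.1 ?_)
    exact ne_top_of_le_ne_top hxT (ENNReal.tsum_le_tsum fun J => hterm J x)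
  · rw [← hN]
    refine le_trans ?_ hHle
    rw [hω, lintegral_withDensity_eq_lintegral_mul _ hv' (hHm.pow_const 2)]
    refine lintegral_mono fun x => ?_
    rw [Pi.mul_apply, mul_comm]
    gcongr
    exact hTle x
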